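/- Let $K$ be a complex Hilbert space, $N\ge 2$, and let $V_0,\dots,V_{N-1}$ be bounded operators on $K$ forming a row co-isometry: $\sum_{i=0}^{N-1}V_iV_i^*=I_K$. Let $\mathcal T$ be a complete metric space and $e:\mathcal T\to K$, $t\mapsto e_t$, a continuous map with $\|e_t\|=1$ for all $t$, such that the closed linear span of $\{e_t:t\in\mathcal T\}$ is $K$. Suppose that $V_i^*e_t=\nu_i(t)e_{g_i(t)}$ for all $i$ and $t$, with $\nu_i(t)\in\mathbb C$ and $g_i(t)\in\mathcal T$, where every map $g_i:\mathcal T\to\mathcal T$ is a contraction (with ratio $<1$). Notation. $\Omega$ is the set of finite words over $\{0,\dots,N-1\}$, including the empty word. For $\omega=\omega_1\cdots\omega_n\in\Omega$ put $V_\omega=V_{\omega_1}\cdots V_{\omega_n}$, $g_\omega=g_{\omega_n}\circ\cdots\circ g_{\omega_1}$ and $\nu_\omega(t)=\nu_{\omega_1}(t)\,\nu_{\omega_2}(g_{\omega_1}(t))\cdots\nu_{\omega_n}(g_{\omega_{n-1}}\cdots g_{\omega_1}(t))$; for the empty word these are the identity, the identity and $1$. A set $M\subseteq\mathcal T$ is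 invariant if $t\in M$ and $\nu_i(t)\ne0$ imply $g_i(t)\in M$. A minimal compact invariant set is a nonempty compact invariant set that has no proper nonempty compact invariant subset. Let $K(M)$ be the closed linear span of $\{e_t:t\in M\}$. For an invariant set $M$, $g_i|_M:M\to M$ denotes the map equal to $g_i(c)$ where $g_i(c)\in M$; at points $c\in M$ with $g_i(c)\notin M$, where necessarily $\nu_i(c)=0$, its value is immaterial and is set to be $c$. Assume in addition that all the maps $g_i$ are injective and that all minimal compact invariant sets are finite. Then there are only finitely many minimal compact invariant sets $M_1,\dots,M_p$ (listed without repetition), and for every $j$ the family $(V_i)$ acts on $K(M_j)$ as an irreducible, separating random walk $(M_j,\{g_i|_{M_j}\},\{\nu_i|_{M_j}\})$. That is: - $M_j$ is finite, $K(M_j)$ is a closed subspace invariant under all $V_i^*$, $(e_c)_{c\in M_j}$ is an orthonormal basis of $K(M_j)$, $V_i^*e_c=\nu_i(c)e_{g_i|_{M_j}(c)}$ for all $i$ and all $c\in M_j$, and whenever $c,c'\in M_j$, $\nu_i(c)\ne0$, $\nu_i(c')\neq 0$ and $g_i(c)=g_i(c')$, then $c=c'$; - (irreducible) for all $c,c'\in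 M_j$ there is $\omega\in\Omega$ with $g_\omega(c)=c'$ and $\nu_\omega(c)\ne0$; - (separating) for all $c\ne c'$ in $M_j$ there is $n$ such that for every $\omega\in\Omega$ of length at least $n$, $\nu_\omega(c)=0$ or $\nu_\omega(c')=0$ (in the last two items $g_\omega$ and $\nu_\omega$ are formed from the restricted maps and weights). Suppose moreover that $(V_i)$ is reversing on each $K(M_j)$, that is, $V_ie_{g_i(c)}=\overline{\nu_i(c)}\,e_c$ for all $c\in M_j$ and all $i$ with $\nu_i(c)\neq0$. For each $j=1,\dots,p$ choose any point $c_j\in M_j$. A cycle word for $c_j$ is a nonempty word $\beta=\beta_1\cdots\beta_m$ with $g_\beta(c_j)=c_j$, $\nu_\beta(c_j)\ne0$ and $g_{\beta_1\cdots\beta_k}(c_j)\neq c_j$ for $1\le k<m$ (again with the restricted maps and weights). Let $\Omega_{c_j}^{(0)}$ be the set of words in $\Omega$ that do not end in a cycle word for $c_j$. Then the family $\{V_\omega e_{c_j}:\omega\in\Omega_{c_j}^{(0)},\ j=1,\dots,p\}$, indexed by the pairs $(j,\omega)$, is a Parseval frame for $K$: $$\|v\|^2=\sum_{j=1}^p\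 \sum_{\omega\in\Omega_{c_j}^{(0)}}|\langle v,V_\omega e_{c_j}\rangle|^2\qquad(v\in K).$$ -/

import Mathlib

noncomputable section

/-- `(K, V_i)_{i < N}` is a row co-isometry: `N ≥ 2` and `∑ i, V_i V_i^* = I_K`. -/
def IsRowCoisometry {K : Type*} [NormedAddCommGroup K] [InnerProductSpace ℂ K] [CompleteSpace K]
    {N : ℕ} (V : Fin N → K →L[ℂ] K) : Prop :=
  2 ≤ N ∧ ∑ i, V i ∘L ContinuousLinearMap.adjoint (V i) = ContinuousLinearMap.id ℂ K

/-- `V_ω = V_{ω_1} ⋯ V_{ω_n}` for a word `ω = ω_1 … ω_n`; the identity for the empty word. -/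
def wordOp {K : Type*} [NormedAddCommGroup K] [InnerProductSpace ℂ K] {N : ℕ}
    (V : Fin N → K →L[ℂ] K) : List (Fin N) → K →L[ℂ] K
  | [] => ContinuousLinearMap.id ℂ K
  | i :: ω => V i ∘L wordOp V ω

/-- `g_ω = g_{ω_n} ∘ ⋯ ∘ g_{ω_1}` for a word `ω = ω_1 … ω_n` (the first letter acts first). -/
def wordMap {X : Type*} {N : ℕ} (g : Fin N → X → X) : List (Fin N) → X → X
  | [], x => x
  | i :: ω, x => wordMap g ω (g i x)

/-- `ν_ω(x) = ν_{ω_1}(x) ν_{ω_2}(g_{ω_1} x) ⋯ ν_{ω_n}(g_{ω_{n-1}} ⋯ g_{ω_1} x)`. -/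
def wordWeight {X : Type*} {N : ℕ} (g : Fin N → X → X) (ν : Fin N → X → ℂ) :
    List (Fin N) → X → ℂ
  | [], _ => 1
  | i :: ω, x => ν i x * wordWeight g ν ω (g i x)

/-- `(V_i)` acts on the closed subspace `K₀` as a random walk on the graph `(M, {g_i}, {ν_i})`,
with orthonormal basis `(e_c)_{c ∈ M}` of `K₀`. -/
structure ActsAsRandomWalk {K : Type*} [NormedAddCommGroup K] [InnerProductSpace ℂ K]
    [CompleteSpace K] {N : ℕ} (V : Fin N → K →L[ℂ] K) (K₀ : Submodule ℂ K) {M : Type*}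
    (e : M → K) (g : Fin N → M → M) (ν : Fin N → M → ℂ) : Prop where
  closed : IsClosed (K₀ : Set K)
  invariant : ∀ i, ∀ x ∈ K₀, ContinuousLinearMap.adjoint (V i) x ∈ K₀
  finite : Finite M
  orthonormal : Orthonormal ℂ e
  span_eq : (Submodule.span ℂ (Set.range e)).topologicalClosure = K₀
  adjoint_apply : ∀ i c, ContinuousLinearMap.adjoint (V i) (e c) = ν i c • e (g i c)
  inj : ∀ i c₁ c₂, ν i c₁ ≠ 0 → ν i c₂ ≠ 0 → g i c₁ = g i c₂ → c₁ = c₂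

/-- The random walk `(M, {g_i}, {ν_i})` is irreducible. -/
def WalkIrreducible {M : Type*} {N : ℕ} (g : Fin N → M → M) (ν : Fin N → M → ℂ) : Prop :=
  ∀ c₁ c₂ : M, ∃ ω : List (Fin N), wordMap g ω c₁ = c₂ ∧ wordWeight g ν ω c₁ ≠ 0

/-- The random walk `(M, {g_i}, {ν_i})` is separating. -/
def WalkSeparating {M : Type*} {N : ℕ} (g : Fin N → M → M) (ν : Fin N → M → ℂ) : Prop :=
  ∀ c₁ c₂ : M, c₁ ≠ c₂ → ∃ n : ℕ, ∀ ω : List (Fin N), n ≤ ω.length →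
    wordWeight g ν ω c₁ = 0 ∨ wordWeight g ν ω c₂ = 0

/-- `{V_i}` is reversing on the random walk `(M, {g_i}, {ν_i})` with basis `(e_c)`. -/
def WalkReversing {K : Type*} [NormedAddCommGroup K] [InnerProductSpace ℂ K] {N : ℕ}
    (V : Fin N → K →L[ℂ] K) {M : Type*} (e : M → K) (g : Fin N → M → M)
    (ν : Fin N → M → ℂ) : Prop :=
  ∀ i c, ν i c ≠ 0 → V i (e (g i c)) = (starRingEnd ℂ) (ν i c) • e c

/-- `β` is a cycle word for `c`: a nonempty word that leads with nonzero weight from `c` to `c`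
without visiting `c` in between. -/
def IsCycleWord {M : Type*} {N : ℕ} (g : Fin N → M → M) (ν : Fin N → M → ℂ) (c : M)
    (β : List (Fin N)) : Prop :=
  β ≠ [] ∧ wordMap g β c = c ∧ (∀ k, 0 < k → k < β.length → wordMap g (β.take k) c ≠ c) ∧
    wordWeight g ν β c ≠ 0

/-- The set of words that do not end in a cycle word for `c`. -/
def wordsNotEndingInCycle {M : Type*} {N : ℕ} (g : Fin N → M → M) (ν : Fin N → M → ℂ) (c : M) :
    Set (List (Fin N)) :=
  {ω | ∀ β, IsCycleWord g ν c β → ¬ β <:+ ω}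

/-- The assumptions on a row co-isometry: a norm-one continuous map `e : T → K` on a complete
metric space, whose range has dense linear span, with `V_i^* e_t = ν_i(t) e_{g_i(t)}` for
contractions `g_i` of `T`. -/
structure CoisometryAssumptions {K : Type*} [NormedAddCommGroup K] [InnerProductSpace ℂ K]
    [CompleteSpace K] {T : Type*} [MetricSpace T] [CompleteSpace T] {N : ℕ}
    (V : Fin N → K →L[ℂ] K) (e : T → K) (g : Fin N → T → T) (ν : Fin N → T → ℂ) : Prop where
  coisometry : IsRowCoisometry V
  continuous : Continuous e
  dense_span : (Submodule.span ℂ (Set.range e)).topologicalClosure = ⊤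
  norm_eq_one : ∀ t, ‖e t‖ = 1
  adjoint_apply : ∀ i t, ContinuousLinearMap.adjoint (V i) (e t) = ν i t • e (g i t)
  contraction : ∀ i, ∃ κ : NNReal, ContractingWith κ (g i)

/-- `M ⊆ T` is invariant: possible transitions from points of `M` stay in `M`. -/
def IsInvariantSet {T : Type*} {N : ℕ} (g : Fin N → T → T) (ν : Fin N → T → ℂ)
    (M : Set T) : Prop :=
  ∀ t ∈ M, ∀ i, ν i t ≠ 0 → g i t ∈ M

/-- Minimal compact invariant sets: minimal among the nonempty compact invariant sets. -/
def IsMinimalCompactInvariant {T : Type*} [TopologicalSpace T] {N : ℕ} (g : Fin N → T → T)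
    (ν : Fin N → T → ℂ) (M : Set T) : Prop :=
  Minimal (fun A : Set T => A.Nonempty ∧ IsCompact A ∧ IsInvariantSet g ν A) M

/-- `K(M)`, the closed linear span of the vectors `e_t`, `t ∈ M`. -/
def spanOn {K : Type*} [NormedAddCommGroup K] [InnerProductSpace ℂ K] {T : Type*} (e : T → K)
    (M : Set T) : Submodule ℂ K :=
  (Submodule.span ℂ (e '' M)).topologicalClosure

open Classical in
/-- The restriction of the maps `g_i` to `M`, as maps `M → M`. If `M` is invariant and
`ν_i(c) ≠ 0` the value at `c` is `g_i(c)`. Where `g_i(c)` is not in `M` (so that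
`ν_i(c) = 0`, and no edge starts at `c` with label `i`) the value is immaterial, and is put
equal to `c`. -/
def restrictMaps {T : Type*} {N : ℕ} (g : Fin N → T → T) (M : Set T) (i : Fin N) (c : M) : M :=
  if h : g i c ∈ M then ⟨g i c, h⟩ else c

/-- The restriction of the weights `ν_i` to `M`. -/
def restrictWeights {T : Type*} {N : ℕ} (ν : Fin N → T → ℂ) (M : Set T) (i : Fin N) (c : M) : ℂ :=
  ν i c

/-- The family `(f_a)` is a Parseval frame: `‖v‖² = ∑ a, |⟨v, f_a⟩|²` for all `v`. -/
def IsParsevalFrame {K : Type*} [NormedAddCommGroup K] [InnerProductSpace ℂ K] {A : Type*}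
    (f : A → K) : Prop :=
  ∀ v : K, HasSum (fun a => ‖inner ℂ v (f a)‖ ^ 2) (‖v‖ ^ 2)

end

open Filter Topology

/-! Separation and finiteness. If one long word had nonzero weight at two distinct points of a
finite invariant set, their images would be distinct by injectivity, hence a fixed distance apart,
yet arbitrarily close by contraction. Expanding `⟨e_c, e_c'⟩` by the co-isometry relation then gives
orthogonality, also across different minimal sets, whose union is again invariant. All minimal sets
lie in the compact closure of a single orbit, so infinitely many orthonormal `e_c` would contradict
continuity of `e` at an accumulation point. Irreducibility holds because the points reachable from
`c` form an invariant subset.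

Frame identity. Let `C` be the union of the minimal sets and `a(ω, c) = |⟨v, V_ω e_c⟩|²`. Reversing
says that this mass flows along edges: `a(ωi, g_i c) = |ν_i(c)|² a(ω, c)`. Hence the total mass
`E_n` over words of length `n` and `c ∈ C` increases with `n`. Two limits remain.

The first is `E_n → ‖v‖²` (`tendsto_sum_words_inner`). For `v = e_t` the gap is `Rⁿf(t)`, with `R`
the transfer operator and `f(t)` the squared distance of `e_t` to the span of `C`. As `f` is
superharmonic and zero on minimal sets, a maximum principle (`tendsto_iterate_transferOp`) forces
`Rⁿf → 0`; density of the span does the rest.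

The second concerns the part of `E_n` at points reached from a base point along a suffix of `ω`.
Passing to length `n + 1` adds to it exactly the frame terms of length `n + 1`
(`sum_reachedEnergy_concat`), so it equals the partial sum of the frame series (`sum_newEnergy`).
The unreached mass tends to zero by a Lyapunov estimate (`tendsto_sum_unreachedEnergy`), since every
point of `C` leads to a base point. -/

theorem wordMap_append {X : Type*} {N : ℕ} (g : Fin N → X → X) (α β : List (Fin N)) (x : X) :
    wordMap g (α ++ β) x = wordMap g β (wordMap g α x) := by
  induction α generalizing x with
  | nil => rfl
  | cons i α ih => exact ih (g i x)

theorem wordWeight_append {X : Type*} {N : ℕ} (g : Fin N → X → X) (ν : Fin N → X → ℂ)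
    (α β : List (Fin N)) (x : X) :
    wordWeight g ν (α ++ β) x = wordWeight g ν α x * wordWeight g ν β (wordMap g α x) := by
  induction α generalizing x with
  | nil => simp [wordWeight, wordMap]
  | cons i α ih => simp [wordWeight, wordMap, ih, mul_assoc]

theorem wordMap_concat {X : Type*} {N : ℕ} (g : Fin N → X → X) (α : List (Fin N)) (i : Fin N)
    (x : X) : wordMap g (α ++ [i]) x = g i (wordMap g α x) := by
  simp [wordMap_append, wordMap]

theorem wordWeight_concat {X : Type*} {N : ℕ} (g : Fin N → X → X) (ν : Fin N → X → ℂ)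
    (α : List (Fin N)) (i : Fin N) (x : X) :
    wordWeight g ν (α ++ [i]) x = wordWeight g ν α x * ν i (wordMap g α x) := by
  simp [wordWeight_append, wordWeight]

theorem wordMap_injective {X : Type*} {N : ℕ} {g : Fin N → X → X}
    (hg : ∀ i, Function.Injective (g i)) (ω : List (Fin N)) :
    Function.Injective (wordMap g ω) := by
  induction ω with
  | nil => exact Function.injective_id
  | cons i ω ih => exact ih.comp (hg i)

theorem IsInvariantSet.wordMap_mem {T : Type*} {N : ℕ} {g : Fin N → T → T} {ν : Fin N → T → ℂ}
    {M : Set T} (hM : IsInvariantSet g ν M) {ω : List (Fin N)} {t : T} (ht : t ∈ M)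
    (hω : wordWeight g ν ω t ≠ 0) : wordMap g ω t ∈ M := by
  induction ω generalizing t with
  | nil => exact ht
  | cons i ω ih => exact ih (hM t ht i (left_ne_zero_of_mul hω)) (right_ne_zero_of_mul hω)

theorem wordOp_append {K : Type*} [NormedAddCommGroup K] [InnerProductSpace ℂ K] {N : ℕ}
    (V : Fin N → K →L[ℂ] K) (α β : List (Fin N)) :
    wordOp V (α ++ β) = wordOp V α ∘L wordOp V β := by
  induction α with
  | nil => ext; simp [wordOp]
  | cons i α ih => simp [wordOp, ih, ContinuousLinearMap.comp_assoc]

theorem wordOp_concat {K : Type*} [NormedAddCommGroup K] [InnerProductSpace ℂ K] {N : ℕ}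
    (V : Fin N → K →L[ℂ] K) (α : List (Fin N)) (i : Fin N) :
    wordOp V (α ++ [i]) = wordOp V α ∘L V i := by
  rw [wordOp_append]; rfl

/-! ### Restriction to an invariant set; the immaterial values never matter -/

section Restriction

variable {T : Type*} {N : ℕ} {g : Fin N → T → T} {ν : Fin N → T → ℂ} {M : Set T}

theorem coe_restrictMaps (hM : IsInvariantSet g ν M) {i : Fin N} {c : M} (h : ν i c ≠ 0) :
    (restrictMaps g M i c : T) = g i c := by
  rw [restrictMaps, dif_pos (hM c c.2 i h)]

/-- A step where the restricted map may differ from `g i` carries the factor `ν i c = 0`, which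
kills both sides. -/
theorem wordWeight_restrict (hM : IsInvariantSet g ν M) (ω : List (Fin N)) (c : M) :
    wordWeight (restrictMaps g M) (restrictWeights ν M) ω c = wordWeight g ν ω c := by
  induction ω generalizing c with
  | nil => rfl
  | cons i ω ih =>
    by_cases h : ν i c = 0
    · simp [wordWeight, restrictWeights, h]
    · simp [wordWeight, ih, coe_restrictMaps hM h, restrictWeights]

theorem coe_wordMap_restrict (hM : IsInvariantSet g ν M) {ω : List (Fin N)} {c : M}
    (h : wordWeight g ν ω c ≠ 0) :
    ((wordMap (restrictMaps g M) ω c : M) : T) = wordMap g ω c := by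
  induction ω generalizing c with
  | nil => rfl
  | cons i ω ih =>
    have hi : ν i c ≠ 0 := left_ne_zero_of_mul h
    have h2 : wordWeight g ν ω (g i c) ≠ 0 := right_ne_zero_of_mul h
    rw [← coe_restrictMaps hM hi] at h2
    have := ih h2
    rwa [coe_restrictMaps hM hi] at this

theorem wordWeight_take_ne_zero {ω : List (Fin N)} {c : T} (h : wordWeight g ν ω c ≠ 0) (k : ℕ) :
    wordWeight g ν (ω.take k) c ≠ 0 := by
  rw [← List.take_append_drop k ω, wordWeight_append] at h
  exact left_ne_zero_of_mul h

theorem isCycleWord_restrict_iff (hM : IsInvariantSet g ν M) (c : M) (β : List (Fin N)) :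
    IsCycleWord (restrictMaps g M) (restrictWeights ν M) c β ↔ IsCycleWord g ν (c : T) β := by
  unfold IsCycleWord
  rw [wordWeight_restrict hM]
  by_cases h : wordWeight g ν β c = 0
  · simp [h]
  · have h1 (k : ℕ) : wordMap (restrictMaps g M) (β.take k) c = c ↔
        wordMap g (β.take k) (c : T) = c := by
      rw [← Subtype.coe_inj, coe_wordMap_restrict hM (wordWeight_take_ne_zero h k)]
    have h2 : wordMap (restrictMaps g M) β c = c ↔ wordMap g β (c : T) = c := by
      rw [← Subtype.coe_inj, coe_wordMap_restrict hM h]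
    simp only [h1, h2, ne_eq]

theorem wordsNotEndingInCycle_restrict (hM : IsInvariantSet g ν M) (c : M) :
    wordsNotEndingInCycle (restrictMaps g M) (restrictWeights ν M) c =
      wordsNotEndingInCycle g ν (c : T) := by
  ext ω
  simp [wordsNotEndingInCycle, isCycleWord_restrict_iff hM]

end Restriction

/-- If a loop revisits `c` early, what remains after that visit is a shorter loop and still a
suffix; induct on length. -/
theorem exists_isCycleWord_suffix {T : Type*} {N : ℕ} {g : Fin N → T → T} {ν : Fin N → T → ℂ}
    {c : T} {γ : List (Fin N)} (hne : γ ≠ []) (hc : wordMap g γ c = c)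
    (hw : wordWeight g ν γ c ≠ 0) : ∃ β, IsCycleWord g ν c β ∧ β <:+ γ := by
  induction hn : γ.length using Nat.strong_induction_on generalizing γ with
  | _ n ih =>
    subst hn
    by_cases h : ∃ k, 0 < k ∧ k < γ.length ∧ wordMap g (γ.take k) c = c
    · obtain ⟨k, hk0, hk, hkc⟩ := h
      have hc' := hc
      have hw' := hw
      rw [← List.take_append_drop k γ, wordMap_append, hkc] at hc'
      rw [← List.take_append_drop k γ, wordWeight_append, hkc] at hw'
      obtain ⟨β, hβ, hs⟩ := ih (γ.drop k).length (by simp; omega)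
        (by rw [ne_eq, List.drop_eq_nil_iff]; omega) hc' (right_ne_zero_of_mul hw') rfl
      exact ⟨β, hβ, hs.trans (List.drop_suffix k γ)⟩
    · push Not at h
      exact ⟨γ, ⟨hne, hc, h, hw⟩, List.suffix_rfl⟩

/-- Removes the first-return condition: arbitrary nonempty loops may replace cycle words. -/
theorem mem_wordsNotEndingInCycle_iff {T : Type*} {N : ℕ} {g : Fin N → T → T}
    {ν : Fin N → T → ℂ} {c : T} {ω : List (Fin N)} :
    ω ∈ wordsNotEndingInCycle g ν c ↔
      ∀ γ, γ <:+ ω → γ ≠ [] → wordMap g γ c = c → wordWeight g ν γ c = 0 := by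
  constructor
  · intro h γ hs hne hc
    by_contra hw
    obtain ⟨β, hβ, hβs⟩ := exists_isCycleWord_suffix hne hc hw
    exact h β hβ (hβs.trans hs)
  · intro h β hβ hs
    exact hβ.2.2.2 (h β hs hβ.1 hβ.2.1)

/-- The words of length `n` in `N` letters. -/
noncomputable def wordsOfLength (N n : ℕ) : Finset (List (Fin N)) :=
  (List.finite_length_eq (Fin N) n).toFinset

theorem mem_wordsOfLength {N n : ℕ} {ω : List (Fin N)} :
    ω ∈ wordsOfLength N n ↔ ω.length = n := by
  simp [wordsOfLength]

theorem sum_wordsOfLength_zero {N : ℕ} {A : Type*} [AddCommMonoid A] (F : List (Fin N) → A) :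
    ∑ ω ∈ wordsOfLength N 0, F ω = F [] := by
  have : wordsOfLength N 0 = {[]} := by ext; simp [mem_wordsOfLength]
  simp [this]

theorem sum_wordsOfLength_succ {N : ℕ} {A : Type*} [AddCommMonoid A] (n : ℕ)
    (F : List (Fin N) → A) :
    ∑ ω ∈ wordsOfLength N (n + 1), F ω = ∑ ω ∈ wordsOfLength N n, ∑ i, F (ω ++ [i]) := by
  rw [← Finset.sum_product']
  symm
  refine Finset.sum_nbij (fun p => p.1 ++ [p.2]) ?_ ?_ ?_ (fun _ _ => rfl)
  · rintro ⟨ω, i⟩ h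
    simpa [mem_wordsOfLength] using h
  · rintro ⟨ω, i⟩ - ⟨ω', i'⟩ - h
    simpa using List.append_inj' h rfl
  · intro ω hω
    have hlen : ω.length = n + 1 := by simpa [mem_wordsOfLength] using hω
    have hne : ω ≠ [] := by rintro rfl; simp at hlen
    refine ⟨(ω.dropLast, ω.getLast hne), ?_, List.dropLast_append_getLast hne⟩
    simp [mem_wordsOfLength, hlen]

theorem exists_pos_forall_le {A : Type*} (s : Finset A) (f : A → ℝ) :
    ∃ p : ℝ, 0 < p ∧ ∀ a ∈ s, 0 < f a → p ≤ f a := by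
  classical
  induction s using Finset.induction_on with
  | empty => exact ⟨1, one_pos, by simp⟩
  | insert a s _ ih =>
    obtain ⟨p, hp, h⟩ := ih
    by_cases ha : 0 < f a
    · refine ⟨min p (f a), lt_min hp ha, fun b hb hb0 => ?_⟩
      rcases Finset.mem_insert.1 hb with rfl | hb
      · exact min_le_right _ _
      · exact (min_le_left _ _).trans (h b hb hb0)
    · refine ⟨p, hp, fun b hb hb0 => ?_⟩
      rcases Finset.mem_insert.1 hb with rfl | hb
      · exact absurd hb0 ha
      · exact h b hb hb0

/-! ### Contractions: separation and compactness of orbit closures -/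

section Contractions

variable {T : Type*} [MetricSpace T] {N : ℕ} {g : Fin N → T → T}

theorem exists_uniform_ratio (hg : ∀ i, ∃ κ : NNReal, ContractingWith κ (g i)) :
    ∃ κ : ℝ, 0 ≤ κ ∧ κ < 1 ∧ ∀ i x y, dist (g i x) (g i y) ≤ κ * dist x y := by
  choose κ hκ using hg
  refine ⟨(Finset.univ.sup κ : NNReal), NNReal.coe_nonneg _, ?_, fun i x y => ?_⟩
  · have : Finset.univ.sup κ < 1 := (Finset.sup_lt_iff one_pos).2 fun i _ => (hκ i).1
    exact_mod_cast this
  · refine ((hκ i).2.dist_le_mul x y).trans ?_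
    gcongr
    exact Finset.le_sup (Finset.mem_univ i)

theorem dist_wordMap_le {κ : ℝ} (h0 : 0 ≤ κ)
    (hκ : ∀ i x y, dist (g i x) (g i y) ≤ κ * dist x y) (ω : List (Fin N)) (x y : T) :
    dist (wordMap g ω x) (wordMap g ω y) ≤ κ ^ ω.length * dist x y := by
  induction ω generalizing x y with
  | nil => simp [wordMap]
  | cons i ω ih =>
    refine (ih _ _).trans ?_
    rw [List.length_cons, pow_succ, mul_assoc]
    gcongr
    exact hκ i x y

theorem walk_separating_of_finite (hg : ∀ i, ∃ κ : NNReal, ContractingWith κ (g i))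
    (hinj : ∀ i, Function.Injective (g i)) {ν : Fin N → T → ℂ} {F : Set T} (hF : F.Finite)
    (hinv : IsInvariantSet g ν F) {c c' : T} (hc : c ∈ F) (hc' : c' ∈ F) (hne : c ≠ c') :
    ∃ n : ℕ, ∀ ω : List (Fin N), n ≤ ω.length →
      wordWeight g ν ω c = 0 ∨ wordWeight g ν ω c' = 0 := by
  obtain ⟨κ, h0, h1, hκ⟩ := exists_uniform_ratio hg
  obtain ⟨p, hp, hpF⟩ := exists_pos_forall_le (hF.toFinset ×ˢ hF.toFinset)
    (fun x => dist x.1 x.2)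
  have hlim : Tendsto (fun n : ℕ => κ ^ n * dist c c') atTop (𝓝 0) := by
    simpa using (tendsto_pow_atTop_nhds_zero_of_lt_one h0 h1).mul_const (dist c c')
  obtain ⟨n, hn⟩ := (hlim.eventually (gt_mem_nhds hp)).exists
  refine ⟨n, fun ω hω => ?_⟩
  by_contra! h
  have hmem := hinv.wordMap_mem hc h.1
  have hmem' := hinv.wordMap_mem hc' h.2
  have hlt : p ≤ dist (wordMap g ω c) (wordMap g ω c') :=
    hpF (wordMap g ω c, wordMap g ω c') (by simp [hmem, hmem'])
      (dist_pos.2 fun h => hne (wordMap_injective hinj ω h))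
  have hle := dist_wordMap_le h0 hκ ω c c'
  have : κ ^ ω.length * dist c c' ≤ κ ^ n * dist c c' :=
    mul_le_mul_of_nonneg_right (pow_le_pow_of_le_one h0 h1.le hω) dist_nonneg
  linarith

/-- The orbit of `t` under all the maps `g_ω`. -/
def wordOrbit {X : Type*} {N : ℕ} (g : Fin N → X → X) (t : X) : Set X :=
  Set.range fun ω => wordMap g ω t

theorem isCompact_closure_wordOrbit [CompleteSpace T]
    (hg : ∀ i, ∃ κ : NNReal, ContractingWith κ (g i)) (t : T) :
    IsCompact (closure (wordOrbit g t)) := by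
  obtain ⟨κ, h0, h1, hκ⟩ := exists_uniform_ratio hg
  obtain ⟨r, hr⟩ : ∃ r : ℝ, ∀ i, dist (g i t) t ≤ r := by
    obtain ⟨r, hr⟩ := (Set.finite_range fun i => dist (g i t) t).bddAbove
    exact ⟨r, fun i => hr ⟨i, rfl⟩⟩
  have hk : 0 < 1 - κ := by linarith
  -- The bound is the fixed point of `R = κ R + max r 0`, so it survives each added letter.
  have hR (ω : List (Fin N)) : dist (wordMap g ω t) t ≤ max r 0 / (1 - κ) := by
    induction ω using List.reverseRecOn with
    | nil => simp only [wordMap, dist_self]; positivity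
    | append_singleton ω i ih =>
      rw [wordMap_concat]
      have h2 : κ * (max r 0 / (1 - κ)) + max r 0 = max r 0 / (1 - κ) := by
        field_simp; ring
      calc dist (g i (wordMap g ω t)) t
          ≤ dist (g i (wordMap g ω t)) (g i t) + dist (g i t) t := dist_triangle _ _ _
        _ ≤ κ * (max r 0 / (1 - κ)) + max r 0 := by
          refine add_le_add ((hκ _ _ _).trans ?_) ((hr i).trans (le_max_left _ _))
          gcongr
        _ = _ := h2
  refine TotallyBounded.isCompact_of_isClosed (TotallyBounded.closure ?_) isClosed_closure
  rw [Metric.totallyBounded_iff]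
  intro ε hε
  have hlim : Tendsto (fun n : ℕ => κ ^ n * (max r 0 / (1 - κ))) atTop (𝓝 0) := by
    simpa using (tendsto_pow_atTop_nhds_zero_of_lt_one h0 h1).mul_const _
  obtain ⟨n, hn⟩ := (hlim.eventually (gt_mem_nhds hε)).exists
  -- Words of length at most `n` give a finite net: a longer word is approximated by its last `n`
  -- letters, which contract whatever came before.
  refine ⟨(fun ω => wordMap g ω t) '' {ω : List (Fin N) | ω.length ≤ n},
    (List.finite_length_le (Fin N) n).image _, ?_⟩
  rintro _ ⟨ω, rfl⟩
  simp only [Set.mem_iUnion]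
  rcases le_total ω.length n with h | h
  · exact ⟨_, ⟨ω, h, rfl⟩, by simpa using hε⟩
  · refine ⟨_, ⟨ω.drop (ω.length - n), by simp; omega, rfl⟩, ?_⟩
    rw [Metric.mem_ball]
    have hlen : (ω.drop (ω.length - n)).length = n := by simp; omega
    calc dist (wordMap g ω t) (wordMap g (ω.drop (ω.length - n)) t)
        = dist (wordMap g (ω.drop (ω.length - n)) (wordMap g (ω.take (ω.length - n)) t))
            (wordMap g (ω.drop (ω.length - n)) t) := by
          rw [← wordMap_append, List.take_append_drop]
      _ ≤ κ ^ n * dist (wordMap g (ω.take (ω.length - n)) t) t := by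
          simpa [hlen] using dist_wordMap_le h0 hκ (ω.drop (ω.length - n)) _ t
      _ ≤ κ ^ n * (max r 0 / (1 - κ)) := by gcongr; exact hR _
      _ < ε := hn

theorem isInvariantSet_closure_wordOrbit (hg : ∀ i, Continuous (g i)) (ν : Fin N → T → ℂ)
    (t : T) : IsInvariantSet g ν (closure (wordOrbit g t)) := by
  intro x hx i _
  refine map_mem_closure (hg i) hx ?_
  rintro _ ⟨ω, rfl⟩
  exact ⟨ω ++ [i], wordMap_concat g ω i t⟩

end Contractions

/-! ### Minimal compact invariant sets -/

section Minimal

theorem exists_isMinimalCompactInvariant {T : Type*} [TopologicalSpace T] [T2Space T] {N : ℕ}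
    {g : Fin N → T → T} {ν : Fin N → T → ℂ} {Y : Set T} (hne : Y.Nonempty) (hY : IsCompact Y)
    (hinv : IsInvariantSet g ν Y) : ∃ M ⊆ Y, IsMinimalCompactInvariant g ν M := by
  refine zorn_superset_nonempty {A : Set T | A.Nonempty ∧ IsCompact A ∧ IsInvariantSet g ν A}
    (fun c hc hchain hcne => ?_) Y ⟨hne, hY, hinv⟩
  have hcl : ∀ s ∈ c, IsClosed s := fun s hs => (hc hs).2.1.isClosed
  refine ⟨⋂₀ c, ⟨?_, ?_, ?_⟩, fun s hs => Set.sInter_subset_of_mem hs⟩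
  · have := hcne.to_subtype
    exact IsCompact.nonempty_sInter_of_directed_nonempty_isCompact_isClosed
      (fun x hx y hy => (hchain.total hx hy).elim (fun h => ⟨x, hx, subset_rfl, h⟩)
        fun h => ⟨y, hy, h, subset_rfl⟩)
      (fun s hs => (hc hs).1) (fun s hs => (hc hs).2.1) hcl
  · obtain ⟨s, hs⟩ := hcne
    exact (hc hs).2.1.of_isClosed_subset (isClosed_sInter hcl) (Set.sInter_subset_of_mem hs)
  · intro t ht i hi s hs
    exact (hc hs).2.2 t (ht s hs) i hi

variable {T : Type*} [TopologicalSpace T] {N : ℕ} {g : Fin N → T → T} {ν : Fin N → T → ℂ}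

theorem IsMinimalCompactInvariant.eq_of_mem [T2Space T] {M M' : Set T}
    (h : IsMinimalCompactInvariant g ν M) (h' : IsMinimalCompactInvariant g ν M') {t : T}
    (ht : t ∈ M) (ht' : t ∈ M') : M = M' := by
  have hP : (M ∩ M').Nonempty ∧ IsCompact (M ∩ M') ∧ IsInvariantSet g ν (M ∩ M') :=
    ⟨⟨t, ht, ht'⟩, h.prop.2.1.inter h'.prop.2.1, fun x hx i hi =>
      ⟨h.prop.2.2 x hx.1 i hi, h'.prop.2.2 x hx.2 i hi⟩⟩
  exact (h.eq_of_subset hP Set.inter_subset_left).symm.trans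
    (h'.eq_of_subset hP Set.inter_subset_right)

theorem IsMinimalCompactInvariant.subset_of_invariant {M A : Set T}
    (h : IsMinimalCompactInvariant g ν M) (hfin : M.Finite) (hne : A.Nonempty) (hA : A ⊆ M)
    (hinv : IsInvariantSet g ν A) : M ⊆ A :=
  h.le_of_le ⟨hne, (hfin.subset hA).isCompact, hinv⟩ hA

theorem IsMinimalCompactInvariant.exists_word {M : Set T}
    (h : IsMinimalCompactInvariant g ν M) (hfin : M.Finite) {c c' : T} (hc : c ∈ M)
    (hc' : c' ∈ M) : ∃ ω, wordMap g ω c = c' ∧ wordWeight g ν ω c ≠ 0 := by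
  refine h.subset_of_invariant (A := {x | ∃ ω, wordMap g ω c = x ∧ wordWeight g ν ω c ≠ 0})
    hfin ⟨c, [], rfl, one_ne_zero⟩ ?_ ?_ hc'
  · rintro _ ⟨ω, rfl, hω⟩
    exact h.prop.2.2.wordMap_mem hc hω
  · rintro _ ⟨ω, rfl, hω⟩ i hi
    exact ⟨ω ++ [i], wordMap_concat g ω i c, by
      rw [wordWeight_concat]; exact mul_ne_zero hω hi⟩

/-- The targets of possible transitions inside `M` form a nonempty invariant subset, hence all of
`M`. So every point has ancestors in `M` of every depth. -/
theorem IsMinimalCompactInvariant.exists_wordMap_eq {M : Set T}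
    (h : IsMinimalCompactInvariant g ν M) (hfin : M.Finite) (hν : ∀ t, ∃ i, ν i t ≠ 0) (n : ℕ)
    {c : T} (hc : c ∈ M) : ∃ ω : List (Fin N), ω.length = n ∧ ∃ t ∈ M, wordMap g ω t = c := by
  have hpred : M ⊆ {x | ∃ i, ∃ t ∈ M, ν i t ≠ 0 ∧ g i t = x} := by
    refine h.subset_of_invariant hfin ?_ ?_ ?_
    · obtain ⟨t, ht⟩ := h.prop.1
      obtain ⟨i, hi⟩ := hν t
      exact ⟨_, i, t, ht, hi, rfl⟩
    · rintro _ ⟨i, t, ht, hi, rfl⟩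
      exact h.prop.2.2 t ht i hi
    · rintro _ ⟨i, t, ht, hi, rfl⟩ j hj
      exact ⟨j, g i t, h.prop.2.2 t ht i hi, hj, rfl⟩
  induction n generalizing c with
  | zero => exact ⟨[], rfl, c, hc, rfl⟩
  | succ n ih =>
    obtain ⟨i, t, ht, -, rfl⟩ := hpred hc
    obtain ⟨ω, hω, s, hs, rfl⟩ := ih ht
    exact ⟨ω ++ [i], by simp [hω], s, hs, wordMap_concat g ω i s⟩

end Minimal

/-- Write `c = g_ω(s)` with `s ∈ M` and `ω` long; then `g_ω(t)` is close to `c`, wherever `t` lies.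
-/
theorem IsMinimalCompactInvariant.subset_closure_wordOrbit {T : Type*} [MetricSpace T] {N : ℕ}
    {g : Fin N → T → T} {ν : Fin N → T → ℂ} (hg : ∀ i, ∃ κ : NNReal, ContractingWith κ (g i))
    (hν : ∀ t, ∃ i, ν i t ≠ 0) {M : Set T} (h : IsMinimalCompactInvariant g ν M)
    (hfin : M.Finite) (t : T) : M ⊆ closure (wordOrbit g t) := by
  intro c hc
  obtain ⟨κ, h0, h1, hκ⟩ := exists_uniform_ratio hg
  obtain ⟨D, hD⟩ := (hfin.image fun s => dist s t).bddAbove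
  rw [Metric.mem_closure_iff]
  intro ε hε
  have hlim : Tendsto (fun n : ℕ => κ ^ n * D) atTop (𝓝 0) := by
    simpa using (tendsto_pow_atTop_nhds_zero_of_lt_one h0 h1).mul_const D
  obtain ⟨n, hn⟩ := (hlim.eventually (gt_mem_nhds hε)).exists
  obtain ⟨ω, rfl, s, hs, rfl⟩ := h.exists_wordMap_eq hfin hν n hc
  refine ⟨_, ⟨ω, rfl⟩, (dist_wordMap_le h0 hκ ω s t).trans_lt (lt_of_le_of_lt ?_ hn)⟩
  gcongr
  exact hD ⟨s, hs, rfl⟩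

/-! ### The transfer operator and a maximum principle -/

section Transfer

/-- The transfer operator `(R f)(t) = ∑ i, |ν_i(t)|² f(g_i(t))`. -/
noncomputable def transferOp {T : Type*} {N : ℕ} (g : Fin N → T → T) (ν : Fin N → T → ℂ)
    (f : T → ℝ) (t : T) : ℝ :=
  ∑ i, ‖ν i t‖ ^ 2 * f (g i t)

variable {T : Type*} {N : ℕ} {g : Fin N → T → T} {ν : Fin N → T → ℂ}

theorem transferOp_mono {f f' : T → ℝ} (h : f ≤ f') : transferOp g ν f ≤ transferOp g ν f' :=
  fun t => Finset.sum_le_sum fun i _ => mul_le_mul_of_nonneg_left (h (g i t)) (by positivity)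

theorem sum_wordWeight_sq_mul (f : T → ℝ) (n : ℕ) (t : T) :
    ∑ ω ∈ wordsOfLength N n, ‖wordWeight g ν ω t‖ ^ 2 * f (wordMap g ω t) =
      (transferOp g ν)^[n] f t := by
  induction n generalizing f with
  | zero => simp [sum_wordsOfLength_zero, wordMap, wordWeight]
  | succ n ih =>
    rw [Function.iterate_succ_apply, ← ih, sum_wordsOfLength_succ]
    refine Finset.sum_congr rfl fun ω _ => ?_
    rw [transferOp, Finset.mul_sum]
    refine Finset.sum_congr rfl fun i _ => ?_
    rw [wordWeight_concat, wordMap_concat, norm_mul, mul_pow, mul_assoc]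

theorem iterate_transferOp_nonneg {f : T → ℝ} (hf : 0 ≤ f) (n : ℕ) :
    0 ≤ (transferOp g ν)^[n] f := by
  induction n with
  | zero => exact hf
  | succ n ih =>
    rw [Function.iterate_succ_apply']
    exact fun t => Finset.sum_nonneg fun i _ => mul_nonneg (by positivity) (ih _)

theorem iterate_transferOp_antitone {f : T → ℝ} (hf : transferOp g ν f ≤ f) :
    Antitone fun n => (transferOp g ν)^[n] f := by
  refine antitone_nat_of_succ_le fun n => ?_
  induction n with
  | zero => exact hf
  | succ n ih =>
    simp only [Function.iterate_succ_apply'] at ih ⊢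
    exact transferOp_mono ih

theorem continuous_iterate_transferOp [TopologicalSpace T] (hg : ∀ i, Continuous (g i))
    (hν : ∀ i, Continuous fun t => ‖ν i t‖) {f : T → ℝ} (hf : Continuous f) (n : ℕ) :
    Continuous ((transferOp g ν)^[n] f) := by
  induction n with
  | zero => exact hf
  | succ n ih =>
    rw [Function.iterate_succ_apply']
    exact continuous_finsetSum _ fun i _ => ((hν i).pow 2).mul (ih.comp (hg i))

/-- A nonnegative continuous superharmonic function that vanishes on all minimal compact
invariant sets is a potential, at points of compact invariant sets. -/
theorem tendsto_iterate_transferOp [TopologicalSpace T] [T2Space T] (hg : ∀ i, Continuous (g i))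
    (hν : ∀ i, Continuous fun t => ‖ν i t‖) (hsum : ∀ t, ∑ i, ‖ν i t‖ ^ 2 = 1)
    {f : T → ℝ} (hf : Continuous f) (h0 : 0 ≤ f) (hsup : transferOp g ν f ≤ f)
    (hmin : ∀ M, IsMinimalCompactInvariant g ν M → ∀ c ∈ M, f c = 0)
    {Y : Set T} (hY : IsCompact Y) (hinv : IsInvariantSet g ν Y) {t : T} (ht : t ∈ Y) :
    Tendsto (fun n => (transferOp g ν)^[n] f t) atTop (𝓝 0) := by
  set F : T → ℝ := fun x => ⨅ n, (transferOp g ν)^[n] f x with hF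
  have hbdd (x : T) : BddBelow (Set.range fun n => (transferOp g ν)^[n] f x) :=
    ⟨0, by rintro _ ⟨n, rfl⟩; exact iterate_transferOp_nonneg h0 n x⟩
  have hlim (x : T) : Tendsto (fun n => (transferOp g ν)^[n] f x) atTop (𝓝 (F x)) :=
    tendsto_atTop_ciInf (fun m n hmn => iterate_transferOp_antitone hsup hmn x) (hbdd x)
  -- The limit need not be continuous, but upper semicontinuity suffices: `F` attains its maximum on
  -- `Y`, and the set of maximum points is closed.
  have husc : UpperSemicontinuous F := upperSemicontinuous_ciInf hbdd fun n =>
    (continuous_iterate_transferOp hg hν hf n).upperSemicontinuous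
  have hharm (x : T) : F x = ∑ i, ‖ν i x‖ ^ 2 * F (g i x) := by
    refine tendsto_nhds_unique ((tendsto_add_atTop_iff_nat 1).2 (hlim x)) ?_
    simp only [Function.iterate_succ_apply']
    exact tendsto_finsetSum _ fun i _ => (hlim (g i x)).const_mul _
  have hF0 (x : T) : 0 ≤ F x := le_ciInf fun n => iterate_transferOp_nonneg h0 n x
  obtain ⟨x, hxY, hx⟩ := (husc.upperSemicontinuousOn Y).exists_isMaxOn ⟨t, ht⟩ hY
  -- At a maximum point the harmonic `F` is an average of values at most `F x`, so every value of
  -- positive weight is maximal too.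
  have hZinv : IsInvariantSet g ν (Y ∩ F ⁻¹' Set.Ici (F x)) := by
    rintro y ⟨hyY, hy⟩ i hi
    refine ⟨hinv y hyY i hi, ?_⟩
    by_contra hlt
    rw [Set.mem_preimage, Set.mem_Ici, not_le] at hlt
    have h1 : F y < ∑ j, ‖ν j y‖ ^ 2 * F x := by
      rw [hharm y]
      refine Finset.sum_lt_sum (fun j _ => ?_) ⟨i, Finset.mem_univ i, ?_⟩
      · by_cases hj : ν j y = 0
        · simp [hj]
        · exact mul_le_mul_of_nonneg_left (hx (hinv y hyY j hj)) (by positivity)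
      · exact mul_lt_mul_of_pos_left hlt (by positivity)
    rw [← Finset.sum_mul, hsum, one_mul] at h1
    exact absurd hy (not_le.2 h1)
  obtain ⟨M, hMZ, hM⟩ := exists_isMinimalCompactInvariant (ν := ν)
    (Y := Y ∩ F ⁻¹' Set.Ici (F x)) ⟨x, hxY, le_refl (F x)⟩
    (hY.inter_right (husc.isClosed_preimage (F x))) hZinv
  obtain ⟨c, hc⟩ := hM.prop.1
  -- The maximum is also attained on a minimal set, where `F ≤ f = 0`.
  have hle : F x ≤ 0 := by
    rw [← hmin M hM c hc]
    exact (Set.mem_Ici.1 (hMZ hc).2).trans (ciInf_le (hbdd c) 0)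
  have : F t = 0 := le_antisymm ((hx ht).trans hle) (hF0 t)
  simpa [this] using hlim t

end Transfer

/-! ### Co-isometry identities and orthogonality -/

section Coisometry

variable {K : Type*} [NormedAddCommGroup K] [InnerProductSpace ℂ K] [CompleteSpace K] {N : ℕ}
  {V : Fin N → K →L[ℂ] K}

theorem IsRowCoisometry.sum_inner (hV : IsRowCoisometry V) (x y : K) :
    ∑ i, inner ℂ (ContinuousLinearMap.adjoint (V i) x) (ContinuousLinearMap.adjoint (V i) y) =
      inner ℂ x y := by
  have h := congrArg (fun A : K →L[ℂ] K => inner ℂ x (A y)) hV.2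
  simpa [sum_apply, inner_sum, ContinuousLinearMap.adjoint_inner_left]
    using h

theorem IsRowCoisometry.sum_norm_sq (hV : IsRowCoisometry V) (x : K) :
    ∑ i, ‖ContinuousLinearMap.adjoint (V i) x‖ ^ 2 = ‖x‖ ^ 2 := by
  have h := hV.sum_inner x x
  simp only [inner_self_eq_norm_sq_to_K] at h
  exact_mod_cast h

theorem adjoint_wordOp_nil_apply (V : Fin N → K →L[ℂ] K) (x : K) :
    ContinuousLinearMap.adjoint (wordOp V []) x = x :=
  ext_inner_left ℂ fun y => by rw [ContinuousLinearMap.adjoint_inner_right]; rfl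

theorem adjoint_wordOp_concat_apply (V : Fin N → K →L[ℂ] K) (ω : List (Fin N)) (i : Fin N)
    (x : K) : ContinuousLinearMap.adjoint (wordOp V (ω ++ [i])) x =
      ContinuousLinearMap.adjoint (V i) (ContinuousLinearMap.adjoint (wordOp V ω) x) := by
  rw [wordOp_concat, ContinuousLinearMap.adjoint_comp]; rfl

theorem IsRowCoisometry.sum_words_norm_sq (hV : IsRowCoisometry V) (n : ℕ) (x : K) :
    ∑ ω ∈ wordsOfLength N n, ‖ContinuousLinearMap.adjoint (wordOp V ω) x‖ ^ 2 = ‖x‖ ^ 2 := by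
  induction n with
  | zero => simp [sum_wordsOfLength_zero, adjoint_wordOp_nil_apply]
  | succ n ih =>
    simp_rw [sum_wordsOfLength_succ, adjoint_wordOp_concat_apply, hV.sum_norm_sq, ih]

variable {T : Type*} {e : T → K} {g : Fin N → T → T} {ν : Fin N → T → ℂ}

theorem adjoint_wordOp_apply
    (he : ∀ i t, ContinuousLinearMap.adjoint (V i) (e t) = ν i t • e (g i t))
    (ω : List (Fin N)) (t : T) :
    ContinuousLinearMap.adjoint (wordOp V ω) (e t) = wordWeight g ν ω t • e (wordMap g ω t) := by
  induction ω using List.reverseRecOn with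
  | nil => simp [adjoint_wordOp_nil_apply, wordWeight, wordMap]
  | append_singleton ω i ih =>
    rw [adjoint_wordOp_concat_apply, ih, map_smul, he, wordWeight_concat, wordMap_concat,
      smul_smul]

/-- Each use of the co-isometry relation expands the inner product over one more letter; after `n`
letters every term has a zero weight. -/
theorem inner_eq_zero_of_separated (hV : IsRowCoisometry V)
    (he : ∀ i t, ContinuousLinearMap.adjoint (V i) (e t) = ν i t • e (g i t)) (n : ℕ) {s t : T}
    (h : ∀ ω : List (Fin N), ω.length = n → wordWeight g ν ω s = 0 ∨ wordWeight g ν ω t = 0) :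
    inner ℂ (e s) (e t) = 0 := by
  induction n generalizing s t with
  | zero => simpa [wordWeight] using h [] rfl
  | succ n ih =>
    rw [← hV.sum_inner]
    refine Finset.sum_eq_zero fun i _ => ?_
    rw [he, he, inner_smul_left, inner_smul_right]
    by_cases hs : ν i s = 0
    · simp [hs]
    by_cases ht : ν i t = 0
    · simp [ht]
    · rw [ih fun ω hω => by simpa [wordWeight, hs, ht] using h (i :: ω) (by simp [hω])]
      simp

end Coisometry

theorem walkIrreducible_of_finite {T : Type*} [TopologicalSpace T] {N : ℕ} {g : Fin N → T → T}
    {ν : Fin N → T → ℂ} {M : Set T} (hfin : M.Finite) (hM : IsMinimalCompactInvariant g ν M) :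
    WalkIrreducible (restrictMaps g M) (restrictWeights ν M) := by
  intro c c'
  obtain ⟨ω, hω, hw⟩ := hM.exists_word (hfin) c.2 c'.2
  refine ⟨ω, Subtype.ext ?_, ?_⟩
  · rw [coe_wordMap_restrict hM.prop.2.2 hw, hω]
  · rwa [wordWeight_restrict hM.prop.2.2]

/-! ### Finiteness of the minimal sets and the random walks on them -/

namespace CoisometryAssumptions

variable {K : Type*} [NormedAddCommGroup K] [InnerProductSpace ℂ K] [CompleteSpace K]
  {T : Type*} [MetricSpace T] [CompleteSpace T] {N : ℕ} {V : Fin N → K →L[ℂ] K} {e : T → K}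
  {g : Fin N → T → T} {ν : Fin N → T → ℂ}

theorem norm_adjoint (hV : CoisometryAssumptions V e g ν) (i : Fin N) (t : T) :
    ‖ContinuousLinearMap.adjoint (V i) (e t)‖ = ‖ν i t‖ := by
  rw [hV.adjoint_apply, norm_smul, hV.norm_eq_one, mul_one]

theorem sum_norm_sq (hV : CoisometryAssumptions V e g ν) (t : T) : ∑ i, ‖ν i t‖ ^ 2 = 1 := by
  simp_rw [← hV.norm_adjoint, hV.coisometry.sum_norm_sq, hV.norm_eq_one, one_pow]

theorem exists_ne_zero (hV : CoisometryAssumptions V e g ν) (t : T) : ∃ i, ν i t ≠ 0 := by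
  by_contra! h
  simpa [h] using hV.sum_norm_sq t

theorem continuous_norm_weight (hV : CoisometryAssumptions V e g ν) (i : Fin N) :
    Continuous fun t => ‖ν i t‖ := by
  simp_rw [← hV.norm_adjoint]
  exact ((ContinuousLinearMap.adjoint (V i)).continuous.comp hV.continuous).norm

theorem continuous_map (hV : CoisometryAssumptions V e g ν) (i : Fin N) : Continuous (g i) := by
  obtain ⟨κ, hκ⟩ := hV.contraction i
  exact hκ.2.continuous

theorem inner_eq_zero (hV : CoisometryAssumptions V e g ν) (hg : ∀ i, Function.Injective (g i))
    {F : Set T} (hF : F.Finite) (hinv : IsInvariantSet g ν F) {c c' : T} (hc : c ∈ F)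
    (hc' : c' ∈ F) (hne : c ≠ c') : inner ℂ (e c) (e c') = 0 := by
  obtain ⟨n, hn⟩ := walk_separating_of_finite hV.contraction hg hF hinv hc hc' hne
  exact inner_eq_zero_of_separated hV.coisometry hV.adjoint_apply n fun ω hω => hn ω hω.ge

/-- For points of different minimal sets `M` and `M'`, the finite invariant set to use is `M ∪ M'`.
-/
theorem orthonormal_minimal (hV : CoisometryAssumptions V e g ν)
    (hg : ∀ i, Function.Injective (g i))
    (hfin : ∀ M : Set T, IsMinimalCompactInvariant g ν M → M.Finite) :
    Orthonormal ℂ fun c : ⋃₀ {M : Set T | IsMinimalCompactInvariant g ν M} => e c := by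
  refine ⟨fun c => hV.norm_eq_one c, ?_⟩
  rintro ⟨c, M, hM, hc⟩ ⟨c', M', hM', hc'⟩ hne
  replace hM : IsMinimalCompactInvariant g ν M := hM
  replace hM' : IsMinimalCompactInvariant g ν M' := hM'
  refine hV.inner_eq_zero hg ((hfin M hM).union (hfin M' hM')) ?_ (Or.inl hc) (Or.inr hc')
    fun h => hne (Subtype.ext h)
  rintro t (ht | ht) i hi
  · exact Or.inl (hM.prop.2.2 t ht i hi)
  · exact Or.inr (hM'.prop.2.2 t ht i hi)

theorem finite_sUnion_minimal (hV : CoisometryAssumptions V e g ν)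
    (hg : ∀ i, Function.Injective (g i))
    (hfin : ∀ M : Set T, IsMinimalCompactInvariant g ν M → M.Finite) :
    (⋃₀ {M : Set T | IsMinimalCompactInvariant g ν M}).Finite := by
  by_contra hinf
  obtain ⟨t, -⟩ := Set.Infinite.nonempty hinf
  obtain ⟨x, -, hx⟩ := Set.Infinite.exists_accPt_of_subset_isCompact hinf
    (isCompact_closure_wordOrbit hV.contraction t)
    (Set.sUnion_subset fun M hM =>
      hM.subset_closure_wordOrbit hV.contraction hV.exists_ne_zero (hfin M hM) t)
  have hU : e ⁻¹' Metric.ball (e x) (1 / 2) ∈ 𝓝 x :=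
    hV.continuous.continuousAt (Metric.ball_mem_nhds _ (by norm_num))
  rw [accPt_iff_nhds] at hx
  obtain ⟨c, ⟨hcU, hc⟩, hcx⟩ := hx _ hU
  -- Removing `c ≠ x` from the neighbourhood yields a second point. Then `e c` and `e c'` are less
  -- than `1` apart, whereas orthonormality makes the distance `√2`.
  obtain ⟨c', ⟨⟨hcU', hcc⟩, hc'⟩, -⟩ := hx _ (Filter.inter_mem hU (isOpen_ne.mem_nhds hcx.symm))
  have hd : dist (e c) (e c') < 1 := by
    have h1 : dist (e c) (e x) < 1 / 2 := hcU
    have h2 : dist (e c') (e x) < 1 / 2 := hcU'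
    linarith [dist_triangle_right (e c) (e c') (e x)]
  have horth := (hV.orthonormal_minimal hg hfin).2
    (i := ⟨c, hc⟩) (j := ⟨c', hc'⟩) (fun h => hcc (congrArg Subtype.val h).symm)
  have h2 : ‖e c - e c'‖ ^ 2 = 2 := by
    rw [@norm_sub_sq ℂ, horth, hV.norm_eq_one, hV.norm_eq_one]; norm_num
  rw [dist_eq_norm] at hd
  nlinarith [norm_nonneg (e c - e c')]

theorem finite_minimal (hV : CoisometryAssumptions V e g ν)
    (hg : ∀ i, Function.Injective (g i))
    (hfin : ∀ M : Set T, IsMinimalCompactInvariant g ν M → M.Finite) :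
    {M : Set T | IsMinimalCompactInvariant g ν M}.Finite :=
  (hV.finite_sUnion_minimal hg hfin).finite_subsets.subset
    fun _ hM => Set.subset_sUnion_of_mem hM

theorem actsAsRandomWalk_minimal (hV : CoisometryAssumptions V e g ν)
    (hg : ∀ i, Function.Injective (g i))
    (hfin : ∀ M : Set T, IsMinimalCompactInvariant g ν M → M.Finite)
    {M : Set T} (hM : IsMinimalCompactInvariant g ν M) :
    ActsAsRandomWalk V (spanOn e M) (fun t : M => e t) (restrictMaps g M)
        (restrictWeights ν M) where
  closed := Submodule.isClosed_topologicalClosure _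
  invariant i x hx := by
    refine map_mem_closure (ContinuousLinearMap.adjoint (V i)).continuous hx ?_
    intro y hy
    refine Submodule.span_induction (p := fun y _ => ContinuousLinearMap.adjoint (V i) y ∈
      Submodule.span ℂ (e '' M)) ?_ (by simp) (fun _ _ _ _ h h' => by
        rw [map_add]; exact add_mem h h') (fun a _ _ h => by
        rw [map_smul]; exact Submodule.smul_mem _ a h) hy
    rintro _ ⟨c, hc, rfl⟩
    rw [hV.adjoint_apply]
    by_cases h : ν i c = 0
    · simp [h]
    · exact Submodule.smul_mem _ _ (Submodule.subset_span ⟨_, hM.prop.2.2 c hc i h, rfl⟩)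
  finite := hfin M hM
  orthonormal := (hV.orthonormal_minimal hg hfin).comp
    (fun c : M => ⟨c, M, hM, c.2⟩) fun c c' h => Subtype.ext (Subtype.mk.inj h)
  span_eq := by rw [spanOn, Set.image_eq_range]
  adjoint_apply i c := by
    rw [hV.adjoint_apply, restrictWeights]
    by_cases h : ν i c = 0
    · simp [h]
    · rw [coe_restrictMaps hM.prop.2.2 h]
  inj i c₁ c₂ h₁ h₂ h := by
    rw [← Subtype.coe_inj, coe_restrictMaps hM.prop.2.2 h₁, coe_restrictMaps hM.prop.2.2 h₂] at h
    exact Subtype.ext (hg i h)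

theorem walkSeparating_minimal (hV : CoisometryAssumptions V e g ν)
    (hg : ∀ i, Function.Injective (g i)) {M : Set T} (hMfin : M.Finite)
    (hM : IsMinimalCompactInvariant g ν M) :
    WalkSeparating (restrictMaps g M) (restrictWeights ν M) := by
  intro c c' hne
  simp_rw [wordWeight_restrict hM.prop.2.2]
  exact walk_separating_of_finite hV.contraction hg hMfin hM.prop.2.2 c.2 c'.2
    fun h => hne (Subtype.ext h)

end CoisometryAssumptions

/-! ### Squared distance to the span of finitely many orthonormal vectors -/

section Defect

variable {K : Type*} [NormedAddCommGroup K] [InnerProductSpace ℂ K] {T : Type*}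

/-- The squared distance of `x` to the span of the orthonormal vectors `e_c`, `c ∈ C`. -/
noncomputable def defect (e : T → K) (C : Finset T) (x : K) : ℝ :=
  ‖x‖ ^ 2 - ∑ c ∈ C, ‖inner ℂ x (e c)‖ ^ 2

variable {e : T → K} {C : Finset T}

theorem defect_le (x : K) : defect e C x ≤ ‖x‖ ^ 2 :=
  sub_le_self _ (Finset.sum_nonneg fun _ _ => by positivity)

theorem defect_nonneg (hC : Orthonormal ℂ fun c : C => e c) (x : K) : 0 ≤ defect e C x := by
  have h := hC.sum_inner_products_le x (s := Finset.univ)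
  rw [C.sum_coe_sort fun c => ‖inner ℂ (e c) x‖ ^ 2] at h
  simp_rw [norm_inner_symm _ x] at h
  exact sub_nonneg.2 h

/-- The defect obeys the parallelogram identity; drop the nonnegative term at `x - y`. -/
theorem defect_add_le (hC : Orthonormal ℂ fun c : C => e c) (x y : K) :
    defect e C (x + y) ≤ 2 * defect e C x + 2 * defect e C y := by
  have h0 := defect_nonneg hC (x - y)
  have h1 := parallelogram_law_with_norm ℂ x y
  have h2 (c : T) : ‖inner ℂ (x + y) (e c)‖ ^ 2 + ‖inner ℂ (x - y) (e c)‖ ^ 2 =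
      2 * ‖inner ℂ x (e c)‖ ^ 2 + 2 * ‖inner ℂ y (e c)‖ ^ 2 := by
    have := parallelogram_law_with_norm ℂ (inner ℂ x (e c)) (inner ℂ y (e c))
    rw [inner_add_left, inner_sub_left]
    nlinarith
  have h3 := Finset.sum_congr (rfl : C = C) fun c _ => h2 c
  simp only [Finset.sum_add_distrib, ← Finset.mul_sum] at h3
  unfold defect at *
  nlinarith

theorem defect_smul (a : ℂ) (x : K) : defect e C (a • x) = ‖a‖ ^ 2 * defect e C x := by
  simp only [defect, inner_smul_left, norm_mul, norm_smul, mul_pow, RCLike.norm_conj, mul_sub,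
    Finset.mul_sum]

theorem defect_apply_self (hC : Orthonormal ℂ fun c : C => e c) {c : T} (hc : c ∈ C) :
    defect e C (e c) = 0 := by
  have h1 : ‖e c‖ = 1 := hC.1 ⟨c, hc⟩
  rw [defect, Finset.sum_eq_single_of_mem c hc, inner_self_eq_norm_sq_to_K, h1]
  · simp
  · intro b hb hbc
    have : inner ℂ (e c) (e b) = 0 :=
      hC.2 (i := ⟨c, hc⟩) (j := ⟨b, hb⟩) fun h => hbc (Subtype.mk.inj h).symm
    simp [this]

theorem continuous_defect : Continuous (defect e C) := by
  unfold defect; fun_prop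

end Defect

/-! ### Flow of mass along the walk: reached and unreached points -/

section Energy

variable {T : Type*} {N : ℕ} {g : Fin N → T → T} {ν : Fin N → T → ℂ}

/-- The weights `a(ω, c)` are consistent on `C` if they propagate along the walk. -/
def ConsistentWeights (g : Fin N → T → T) (ν : Fin N → T → ℂ) (C : Finset T)
    (a : List (Fin N) → T → ℝ) : Prop :=
  ∀ ω, ∀ c ∈ C, ∀ i, ν i c ≠ 0 → a (ω ++ [i]) (g i c) = ‖ν i c‖ ^ 2 * a ω c

/-- The change of variables `x = g_i(c)`, where injectivity enters; edges of weight zero contribute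
nothing. -/
theorem ConsistentWeights.sum_image [DecidableEq T] {C : Finset T} {a : List (Fin N) → T → ℝ}
    (ha : ConsistentWeights g ν C a) (hg : ∀ i, Function.Injective (g i)) (ω : List (Fin N))
    (i : Fin N) {D : Finset T} (hD : D ⊆ C) (u : T → ℝ) :
    ∑ x ∈ (D.filter fun c => ν i c ≠ 0).image (g i), u x * a (ω ++ [i]) x =
      ∑ c ∈ D, ‖ν i c‖ ^ 2 * u (g i c) * a ω c := by
  rw [Finset.sum_image fun x _ y _ h => hg i h, Finset.sum_filter]
  refine Finset.sum_congr rfl fun c hc => ?_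
  split_ifs with h
  · rw [ha ω c (hD hc) i h]; ring
  · rw [not_not.1 h]; simp

theorem ConsistentWeights.sum_sum_image [DecidableEq T] {C : Finset T}
    {a : List (Fin N) → T → ℝ} (ha : ConsistentWeights g ν C a)
    (hg : ∀ i, Function.Injective (g i)) (hsum : ∀ t, ∑ i, ‖ν i t‖ ^ 2 = 1)
    (ω : List (Fin N)) {D : Finset T} (hD : D ⊆ C) :
    ∑ i, ∑ x ∈ (D.filter fun c => ν i c ≠ 0).image (g i), a (ω ++ [i]) x = ∑ c ∈ D, a ω c := by
  have h (i : Fin N) := ha.sum_image hg ω i hD fun _ => 1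
  simp only [one_mul, mul_one] at h
  simp_rw [h]
  rw [Finset.sum_comm]
  simp_rw [← Finset.sum_mul, hsum, one_mul]

/-- Mass is conserved along edges, and points of `C` with no incoming edge labelled `i` can only add
to it. -/
theorem ConsistentWeights.sum_le {C : Finset T} {a : List (Fin N) → T → ℝ}
    (ha : ConsistentWeights g ν C a) (ha0 : ∀ ω c, 0 ≤ a ω c) (hg : ∀ i, Function.Injective (g i))
    (hsum : ∀ t, ∑ i, ‖ν i t‖ ^ 2 = 1) (hC : IsInvariantSet g ν (C : Set T))
    (ω : List (Fin N)) : ∑ c ∈ C, a ω c ≤ ∑ i, ∑ c ∈ C, a (ω ++ [i]) c := by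
  classical
  rw [← ha.sum_sum_image hg hsum ω subset_rfl]
  refine Finset.sum_le_sum fun i _ =>
    Finset.sum_le_sum_of_subset_of_nonneg (fun x hx => ?_) fun _ _ _ => ha0 _ _
  obtain ⟨c, hc, rfl⟩ := Finset.mem_image.1 hx
  obtain ⟨hcC, hi⟩ := Finset.mem_filter.1 hc
  exact hC c hcC i hi

/-- `c` is reached from a base point along a suffix of `ω`, with nonzero weight. -/
def ReachedFrom {ι : Type*} (g : Fin N → T → T) (ν : Fin N → T → ℂ) (b : ι → T)
    (ω : List (Fin N)) (c : T) : Prop :=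
  ∃ j γ, γ <:+ ω ∧ wordMap g γ (b j) = c ∧ wordWeight g ν γ (b j) ≠ 0

variable {ι : Type*} {b : ι → T} {C : Finset T}

theorem reachedFrom_base (ω : List (Fin N)) (j : ι) : ReachedFrom g ν b ω (b j) :=
  ⟨j, [], List.nil_suffix, rfl, one_ne_zero⟩

theorem ReachedFrom.concat {ω : List (Fin N)} {c : T} (h : ReachedFrom g ν b ω c) {i : Fin N}
    (hi : ν i c ≠ 0) : ReachedFrom g ν b (ω ++ [i]) (g i c) := by
  obtain ⟨j, γ, hs, rfl, hw⟩ := h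
  refine ⟨j, γ ++ [i], ?_, wordMap_concat _ _ _ _, ?_⟩
  · obtain ⟨α, rfl⟩ := hs
    exact ⟨α, by simp⟩
  · rw [wordWeight_concat]; exact mul_ne_zero hw hi

theorem reachedFrom_concat_iff {ω : List (Fin N)} {i : Fin N} {x : T} :
    ReachedFrom g ν b (ω ++ [i]) x ↔
      (∃ j, b j = x) ∨ ∃ c, ReachedFrom g ν b ω c ∧ ν i c ≠ 0 ∧ g i c = x := by
  constructor
  · rintro ⟨j, γ, hs, rfl, hw⟩
    rcases γ.eq_nil_or_concat' with rfl | ⟨δ, k, rfl⟩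
    · exact Or.inl ⟨j, rfl⟩
    · right
      obtain ⟨α, hα⟩ := hs
      rw [← List.append_assoc] at hα
      obtain ⟨rfl, h⟩ := List.append_inj' hα rfl
      obtain rfl : k = i := by simpa using h
      rw [wordWeight_concat] at hw
      exact ⟨_, ⟨j, δ, List.suffix_append _ _, rfl, left_ne_zero_of_mul hw⟩,
        right_ne_zero_of_mul hw, (wordMap_concat _ _ _ _).symm⟩
  · rintro (⟨j, rfl⟩ | ⟨c, hc, hi, rfl⟩)
    · exact reachedFrom_base _ j
    · exact hc.concat hi

/-- A word ends in a cycle word for a base point exactly if the base point is the end of an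
edge labelled by the last letter, whose origin is reached from a base point. -/
theorem mem_wordsNotEndingInCycle_concat_iff
    (hb : ∀ j k γ, wordMap g γ (b j) = b k → wordWeight g ν γ (b j) ≠ 0 → j = k)
    {ω : List (Fin N)} {i : Fin N} {j : ι} :
    ω ++ [i] ∈ wordsNotEndingInCycle g ν (b j) ↔
      ¬ ∃ c, ReachedFrom g ν b ω c ∧ ν i c ≠ 0 ∧ g i c = b j := by
  rw [mem_wordsNotEndingInCycle_iff]
  constructor
  · rintro h ⟨c, ⟨k, γ, ⟨α, rfl⟩, rfl, hw⟩, hi, hc⟩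
    have hw' : wordWeight g ν (γ ++ [i]) (b k) ≠ 0 := by
      rw [wordWeight_concat]; exact mul_ne_zero hw hi
    rw [← wordMap_concat g] at hc
    obtain rfl := hb k j _ hc hw'
    exact hw' (h (γ ++ [i]) ⟨α, by simp⟩ (by simp) hc)
  · intro h γ hs hne hc
    by_contra hw
    rcases γ.eq_nil_or_concat' with rfl | ⟨δ, k, rfl⟩
    · exact hne rfl
    · obtain ⟨α, hα⟩ := hs
      rw [← List.append_assoc] at hα
      obtain ⟨rfl, h'⟩ := List.append_inj' hα rfl
      obtain rfl : k = i := by simpa using h'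
      rw [wordWeight_concat] at hw
      rw [wordMap_concat] at hc
      exact h ⟨_, ⟨j, δ, List.suffix_append _ _, rfl, left_ne_zero_of_mul hw⟩,
        right_ne_zero_of_mul hw, hc⟩

open Classical in
/-- The total weight of the pairs `(ω, b_j)` for which `ω` does not end in a cycle word. -/
noncomputable def newEnergy [Fintype ι] (g : Fin N → T → T) (ν : Fin N → T → ℂ) (b : ι → T)
    (a : List (Fin N) → T → ℝ) (ω : List (Fin N)) : ℝ :=
  ∑ j, if ω ∈ wordsNotEndingInCycle g ν (b j) then a ω (b j) else 0

open Classical in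
/-- The total weight of the points reached from a base point. -/
noncomputable def reachedEnergy (g : Fin N → T → T) (ν : Fin N → T → ℂ) (b : ι → T)
    (C : Finset T) (a : List (Fin N) → T → ℝ) (ω : List (Fin N)) : ℝ :=
  ∑ c ∈ C with ReachedFrom g ν b ω c, a ω c

open Classical in
/-- The weight, with factors `u`, of the points not reached from a base point. -/
noncomputable def unreachedEnergy (g : Fin N → T → T) (ν : Fin N → T → ℂ) (b : ι → T)
    (C : Finset T) (a : List (Fin N) → T → ℝ) (u : T → ℝ) (ω : List (Fin N)) : ℝ :=
  ∑ c ∈ C with ¬ ReachedFrom g ν b ω c, u c * a ω c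

theorem reachedEnergy_add_unreachedEnergy (a : List (Fin N) → T → ℝ) (ω : List (Fin N)) :
    reachedEnergy g ν b C a ω + unreachedEnergy g ν b C a (fun _ => 1) ω = ∑ c ∈ C, a ω c := by
  classical
  simp only [reachedEnergy, unreachedEnergy, one_mul]
  exact Finset.sum_filter_add_sum_filter_not C _ _

variable {a : List (Fin N) → T → ℝ}

/-- After a letter `i`, the reached points are the images of the previously reached ones, whose mass
is conserved, together with the base points not among them. The latter are those for which `ω ++
[i]` ends in no cycle word. -/
theorem sum_reachedEnergy_concat [Fintype ι] (ha : ConsistentWeights g ν C a)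
    (hg : ∀ i, Function.Injective (g i)) (hsum : ∀ t, ∑ i, ‖ν i t‖ ^ 2 = 1)
    (hC : IsInvariantSet g ν (C : Set T)) (hbC : ∀ j, b j ∈ C)
    (hb : ∀ j k γ, wordMap g γ (b j) = b k → wordWeight g ν γ (b j) ≠ 0 → j = k)
    (ω : List (Fin N)) :
    ∑ i, reachedEnergy g ν b C a (ω ++ [i]) =
      reachedEnergy g ν b C a ω + ∑ i, newEnergy g ν b a (ω ++ [i]) := by
  classical
  have hinj : Function.Injective b := fun j k h => hb j k [] h one_ne_zero
  have hmem {ω : List (Fin N)} {c : T} (h : ReachedFrom g ν b ω c) : c ∈ C := by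
    obtain ⟨j, γ, -, rfl, hw⟩ := h
    exact hC.wordMap_mem (hbC j) hw
  have hstep (i : Fin N) : reachedEnergy g ν b C a (ω ++ [i]) =
      ∑ x ∈ ((C.filter (ReachedFrom g ν b ω)).filter fun c => ν i c ≠ 0).image (g i),
        a (ω ++ [i]) x + newEnergy g ν b a (ω ++ [i]) := by
    have h1 : newEnergy g ν b a (ω ++ [i]) = ∑ x ∈ (Finset.univ.filter fun j =>
        ω ++ [i] ∈ wordsNotEndingInCycle g ν (b j)).image b, a (ω ++ [i]) x := by
      rw [Finset.sum_image fun x _ y _ h => hinj h, Finset.sum_filter, newEnergy]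
    rw [h1, reachedEnergy, ← Finset.sum_union]
    · refine Finset.sum_congr ?_ fun _ _ => rfl
      ext x
      simp only [Finset.mem_filter, Finset.mem_union, Finset.mem_image, Finset.mem_univ,
        true_and, mem_wordsNotEndingInCycle_concat_iff hb]
      constructor
      · rintro ⟨-, h⟩
        by_cases hx : ∃ c, ReachedFrom g ν b ω c ∧ ν i c ≠ 0 ∧ g i c = x
        · obtain ⟨c, hc, hi, rfl⟩ := hx
          exact Or.inl ⟨c, ⟨⟨hmem hc, hc⟩, hi⟩, rfl⟩
        · obtain ⟨j, rfl⟩ := (reachedFrom_concat_iff.1 h).resolve_right hx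
          exact Or.inr ⟨j, hx, rfl⟩
      · rintro (⟨c, ⟨⟨-, hc⟩, hi⟩, rfl⟩ | ⟨j, -, rfl⟩)
        · exact ⟨hmem (hc.concat hi), hc.concat hi⟩
        · exact ⟨hbC j, reachedFrom_base _ j⟩
    · rw [Finset.disjoint_left]
      intro x hx hx'
      simp only [Finset.mem_filter, Finset.mem_image, Finset.mem_univ, true_and,
        mem_wordsNotEndingInCycle_concat_iff hb] at hx hx'
      obtain ⟨c, ⟨⟨-, hc⟩, hi⟩, rfl⟩ := hx
      obtain ⟨j, hj, hjc⟩ := hx'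
      exact hj ⟨c, hc, hi, hjc.symm⟩
  simp_rw [hstep, Finset.sum_add_distrib]
  rw [ha.sum_sum_image hg hsum ω (Finset.filter_subset _ _), reachedEnergy]

/-- A newly unreached point either is the image of an unreached one, where the Lyapunov inequality
applies because base points are always reached, or has no incoming edge labelled `i`. The latter are
paid for by the growth of the total mass. -/
theorem sum_unreachedEnergy_concat_le (ha : ConsistentWeights g ν C a) (ha0 : ∀ ω c, 0 ≤ a ω c)
    (hg : ∀ i, Function.Injective (g i)) (hsum : ∀ t, ∑ i, ‖ν i t‖ ^ 2 = 1)
    (hC : IsInvariantSet g ν (C : Set T)) {u : T → ℝ} (hu0 : ∀ t, 0 ≤ u t) (hu1 : ∀ t, u t ≤ 1)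
    {ε : ℝ} (hu : ∀ c ∈ C, (∀ j, b j ≠ c) → ∑ i, ‖ν i c‖ ^ 2 * u (g i c) ≤ u c - ε)
    (ω : List (Fin N)) :
    ∑ i, unreachedEnergy g ν b C a u (ω ++ [i]) ≤
      unreachedEnergy g ν b C a u ω - ε * unreachedEnergy g ν b C a (fun _ => 1) ω +
        (∑ i, ∑ c ∈ C, a (ω ++ [i]) c - ∑ c ∈ C, a ω c) := by
  classical
  set D := C.filter fun c => ¬ ReachedFrom g ν b ω c with hD
  set I : Fin N → Finset T := fun i => (C.filter fun c => ν i c ≠ 0).image (g i) with hI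
  have hIC (i : Fin N) : I i ⊆ C := by
    intro x hx
    simp only [hI, Finset.mem_image, Finset.mem_filter] at hx
    obtain ⟨c, ⟨hc, hi⟩, rfl⟩ := hx
    exact hC c hc i hi
  have hstep (i : Fin N) : unreachedEnergy g ν b C a u (ω ++ [i]) ≤
      ∑ c ∈ D, ‖ν i c‖ ^ 2 * u (g i c) * a ω c +
        (∑ c ∈ C, a (ω ++ [i]) c - ∑ c ∈ I i, a (ω ++ [i]) c) := by
    rw [← ha.sum_image hg ω i (Finset.filter_subset _ _), unreachedEnergy,
      ← Finset.sum_sdiff_eq_sub (hIC i)]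
    have hdisj : Disjoint ((D.filter fun c => ν i c ≠ 0).image (g i)) (C \ I i) :=
      (Finset.disjoint_sdiff (s := I i)).mono_left (Finset.image_subset_image
        (Finset.filter_subset_filter _ (Finset.filter_subset _ _)))
    have hsub : (C.filter fun c => ¬ ReachedFrom g ν b (ω ++ [i]) c) ⊆
        (D.filter fun c => ν i c ≠ 0).image (g i) ∪ C \ I i := by
      intro x hx
      obtain ⟨hxC, hx⟩ := Finset.mem_filter.1 hx
      rw [Finset.mem_union, Finset.mem_sdiff]
      by_cases hxI : x ∈ I i
      · left
        obtain ⟨c, hc, rfl⟩ := Finset.mem_image.1 hxI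
        obtain ⟨hcC, hi⟩ := Finset.mem_filter.1 hc
        exact Finset.mem_image_of_mem _ (Finset.mem_filter.2
          ⟨Finset.mem_filter.2 ⟨hcC, fun h => hx (h.concat hi)⟩, hi⟩)
      · exact Or.inr ⟨hxC, hxI⟩
    refine (Finset.sum_le_sum_of_subset_of_nonneg hsub
      fun x _ _ => mul_nonneg (hu0 x) (ha0 _ _)).trans ?_
    rw [Finset.sum_union hdisj]
    gcongr with x
    exact mul_le_of_le_one_left (ha0 _ _) (hu1 x)
  refine (Finset.sum_le_sum fun i _ => hstep i).trans ?_
  rw [Finset.sum_add_distrib, Finset.sum_sub_distrib, ha.sum_sum_image hg hsum ω subset_rfl,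
    Finset.sum_comm]
  refine add_le_add_left ?_ _
  simp_rw [unreachedEnergy, ← hD, Finset.mul_sum, ← Finset.sum_sub_distrib, ← Finset.sum_mul]
  refine Finset.sum_le_sum fun c hc => ?_
  obtain ⟨hcC, hcD⟩ := Finset.mem_filter.1 hc
  have := mul_le_mul_of_nonneg_right (hu c hcC fun j hj => hcD (hj ▸ reachedFrom_base ω j))
    (ha0 ω c)
  linarith

/-- A Lyapunov function: a bounded function that decreases on average by a fixed amount off the
base points. -/
theorem exists_lyapunov (hsum : ∀ t, ∑ i, ‖ν i t‖ ^ 2 = 1)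
    (hpath : ∀ c ∈ C, ∃ ω j, wordMap g ω c = b j ∧ wordWeight g ν ω c ≠ 0) :
    ∃ (u : T → ℝ) (ε : ℝ), 0 < ε ∧ (∀ t, 0 ≤ u t) ∧ (∀ t, u t ≤ 1) ∧
      ∀ c ∈ C, (∀ j, b j ≠ c) → ∑ i, ‖ν i c‖ ^ 2 * u (g i c) ≤ u c - ε := by
  classical
  set S : T → Set ℕ := fun c =>
    {n | ∃ ω : List (Fin N), ω.length = n ∧ ∃ j, wordMap g ω c = b j ∧ wordWeight g ν ω c ≠ 0}
    with hS
  obtain ⟨p, hp, hpC⟩ := exists_pos_forall_le ((Finset.univ : Finset (Fin N)) ×ˢ C)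
    fun x => ‖ν x.1 x.2‖ ^ 2
  -- With `d = sInf (S c)` the number of steps from `c` to the base points and `u = 1 - q ^ d`, one
  -- edge towards a base point has weight at least `p ≥ 2q`. So the average of `q ^ d` after a step
  -- is at least `2 q ^ d`, a gain of `q ^ d ≥ q ^ D * q`. The default `sInf ∅ = 0` is harmless, as
  -- only `0 ≤ u ≤ 1` is needed there.
  set q : ℝ := min p 1 / 2 with hq
  have hq0 : 0 < q := by positivity
  have hq1 : q ≤ 1 := by have := min_le_right p 1; linarith
  have hqp : 2 * q ≤ p := by have := min_le_left p 1; linarith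
  set D := C.sup fun c => sInf (S c) with hD
  refine ⟨fun t => 1 - q ^ sInf (S t), q ^ D * q, by positivity,
    fun t => sub_nonneg.2 (pow_le_one₀ hq0.le hq1), fun t => sub_le_self _ (by positivity), ?_⟩
  intro c hc hcb
  have hne : (S c).Nonempty := by
    obtain ⟨ω, j, hω, hw⟩ := hpath c hc
    exact ⟨_, ω, rfl, j, hω, hw⟩
  obtain ⟨ω, hlen, j, hω, hw⟩ := Nat.sInf_mem hne
  have hcD : sInf (S c) ≤ D := Finset.le_sup (f := fun c => sInf (S c)) hc
  cases ω with
  | nil => exact absurd hω.symm (hcb j)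
  | cons i ω =>
    have hi : ν i c ≠ 0 := left_ne_zero_of_mul hw
    have hle : sInf (S (g i c)) ≤ ω.length :=
      Nat.sInf_le ⟨ω, rfl, j, hω, right_ne_zero_of_mul hw⟩
    beta_reduce
    rw [← hlen, List.length_cons] at hcD ⊢
    have h1 : q ^ ω.length ≤ q ^ sInf (S (g i c)) := pow_le_pow_of_le_one hq0.le hq1 hle
    have h2 : q ^ D ≤ q ^ ω.length := pow_le_pow_of_le_one hq0.le hq1 (by omega)
    have h3 : p ≤ ‖ν i c‖ ^ 2 := hpC (i, c) (by simp [hc]) (by positivity)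
    have h4 : ‖ν i c‖ ^ 2 * q ^ sInf (S (g i c)) ≤ ∑ k, ‖ν k c‖ ^ 2 * q ^ sInf (S (g k c)) :=
      Finset.single_le_sum (f := fun k => ‖ν k c‖ ^ 2 * q ^ sInf (S (g k c)))
        (fun k _ => by positivity) (Finset.mem_univ i)
    have h5 : 2 * q * q ^ ω.length ≤ ‖ν i c‖ ^ 2 * q ^ sInf (S (g i c)) :=
      mul_le_mul (hqp.trans h3) h1 (by positivity) (by positivity)
    have h6 : q ^ D * q ≤ q ^ ω.length * q := mul_le_mul_of_nonneg_right h2 hq0.le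
    simp only [mul_sub, mul_one, Finset.sum_sub_distrib, hsum]
    rw [pow_succ]
    linarith

end Energy

/-- For nonnegative terms, one exhausting sequence of finite sets determines the unordered sum. -/
theorem hasSum_of_tendsto_sum_wordsOfLength {N : ℕ} {F : List (Fin N) → ℝ} (hF : ∀ ω, 0 ≤ F ω)
    {L : ℝ} (hL : Tendsto (fun n => ∑ k ∈ Finset.range (n + 1), ∑ ω ∈ wordsOfLength N k, F ω)
      atTop (𝓝 L)) : HasSum F L := by
  classical
  set P : ℕ → Finset (List (Fin N)) := fun n => (Finset.range (n + 1)).biUnion (wordsOfLength N)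
    with hP
  have hmem {n : ℕ} {ω : List (Fin N)} : ω ∈ P n ↔ ω.length < n + 1 := by
    simp [hP, mem_wordsOfLength]
  have hsum (n : ℕ) : ∑ ω ∈ P n, F ω =
      ∑ k ∈ Finset.range (n + 1), ∑ ω ∈ wordsOfLength N k, F ω := by
    refine Finset.sum_biUnion fun k _ l _ hkl => Finset.disjoint_left.2 fun ω hk hl => hkl ?_
    rw [← mem_wordsOfLength.1 hk, ← mem_wordsOfLength.1 hl]
  simp_rw [← hsum] at hL
  have hmono : Monotone P := fun m n hmn ω hω => hmem.2 ((hmem.1 hω).trans_le (by omega))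
  have htop : Tendsto P atTop atTop :=
    tendsto_atTop_finset_of_monotone hmono fun ω => ⟨ω.length, hmem.2 (Nat.lt_succ_self _)⟩
  have hS : Summable F := by
    refine summable_of_sum_le (c := L) hF fun s => ?_
    obtain ⟨n, hn⟩ := (htop.eventually (eventually_ge_atTop s)).exists
    refine (Finset.sum_le_sum_of_subset_of_nonneg hn fun ω _ _ => hF ω).trans ?_
    exact Monotone.ge_of_tendsto (f := fun n => ∑ ω ∈ P n, F ω)
      (fun m n hmn => Finset.sum_le_sum_of_subset_of_nonneg (hmono hmn) fun ω _ _ => hF ω) hL n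
  have h := hS.hasSum
  rwa [tendsto_nhds_unique (h.comp htop) hL] at h

theorem hasSum_sigma_of_hasSum_sum_indicator {ι A : Type*} [Fintype ι] {S : ι → Set A}
    {f : ι → A → ℝ} (hf : ∀ j x, 0 ≤ f j x) {L : ℝ}
    (h : HasSum (fun x => ∑ j, (S j).indicator (f j) x) L) :
    HasSum (fun p : Σ j, S j => f p.1 p.2) L := by
  have h0 (j : ι) (x : A) : 0 ≤ (S j).indicator (f j) x :=
    Set.indicator_nonneg (fun x _ => hf j x) x
  have hs (j : ι) : Summable ((S j).indicator (f j)) :=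
    Summable.of_nonneg_of_le (h0 j)
      (fun x => Finset.single_le_sum (f := fun j => (S j).indicator (f j) x)
        (fun k _ => h0 k x) (Finset.mem_univ j)) h.summable
  have hL : ∑ j, ∑' x, (S j).indicator (f j) x = L :=
    (hasSum_sum fun j _ => (hs j).hasSum).unique h
  have hsub (j : ι) : HasSum (fun x : S j => f j x) (∑' x, (S j).indicator (f j) x) :=
    hasSum_subtype_iff_indicator.2 (hs j).hasSum
  have hfin : HasSum (fun j => ∑' x, (S j).indicator (f j) x) L := by
    rw [← hL]; exact hasSum_fintype _
  have hsum : Summable fun p : Σ j, S j => f p.1 p.2 :=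
    (summable_sigma_of_nonneg (f := fun p : Σ j, S j => f p.1 p.2) fun p => hf p.1 p.2).2
      ⟨fun j => (hsub j).summable, (hasSum_fintype _).summable⟩
  exact HasSum.sigma_of_hasSum (f := fun p : Σ j, S j => f p.1 p.2) hfin hsub hsum

/-! ### Limits of the masses -/

section Energy

variable {T : Type*} {N : ℕ} {g : Fin N → T → T} {ν : Fin N → T → ℂ} {ι : Type*} {b : ι → T}
  {C : Finset T} {a : List (Fin N) → T → ℝ}

theorem unreachedEnergy_nonneg (ha0 : ∀ ω c, 0 ≤ a ω c) {u : T → ℝ} (hu : ∀ t, 0 ≤ u t)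
    (ω : List (Fin N)) : 0 ≤ unreachedEnergy g ν b C a u ω :=
  Finset.sum_nonneg fun c _ => mul_nonneg (hu c) (ha0 ω c)

theorem tendsto_sum_unreachedEnergy (ha : ConsistentWeights g ν C a) (ha0 : ∀ ω c, 0 ≤ a ω c)
    (hg : ∀ i, Function.Injective (g i)) (hsum : ∀ t, ∑ i, ‖ν i t‖ ^ 2 = 1)
    (hC : IsInvariantSet g ν (C : Set T))
    (hpath : ∀ c ∈ C, ∃ ω j, wordMap g ω c = b j ∧ wordWeight g ν ω c ≠ 0) {L : ℝ}
    (hL : ∀ n, ∑ ω ∈ wordsOfLength N n, ∑ c ∈ C, a ω c ≤ L) :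
    Tendsto (fun n => ∑ ω ∈ wordsOfLength N n, unreachedEnergy g ν b C a (fun _ => 1) ω)
      atTop (𝓝 0) := by
  obtain ⟨u, ε, hε, hu0, hu1, hu⟩ := exists_lyapunov hsum hpath
  set B : ℕ → ℝ := fun n =>
    ∑ ω ∈ wordsOfLength N n, unreachedEnergy g ν b C a (fun _ => 1) ω with hB
  set W : ℕ → ℝ := fun n => ∑ ω ∈ wordsOfLength N n, unreachedEnergy g ν b C a u ω with hW
  set E : ℕ → ℝ := fun n => ∑ ω ∈ wordsOfLength N n, ∑ c ∈ C, a ω c with hE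
  have hB0 (n : ℕ) : 0 ≤ B n :=
    Finset.sum_nonneg fun ω _ => unreachedEnergy_nonneg ha0 (fun _ => zero_le_one) ω
  have hW0 (n : ℕ) : 0 ≤ W n :=
    Finset.sum_nonneg fun ω _ => unreachedEnergy_nonneg ha0 hu0 ω
  have hE0 (n : ℕ) : 0 ≤ E n :=
    Finset.sum_nonneg fun ω _ => Finset.sum_nonneg fun c _ => ha0 ω c
  have hstep (n : ℕ) : W (n + 1) ≤ W n - ε * B n + (E (n + 1) - E n) := by
    simp only [hW, hB, hE, sum_wordsOfLength_succ n, Finset.mul_sum, ← Finset.sum_sub_distrib,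
      ← Finset.sum_add_distrib]
    exact Finset.sum_le_sum fun ω _ =>
      sum_unreachedEnergy_concat_le ha ha0 hg hsum hC hu0 hu1 hu ω
  -- Telescoping `hstep`; as `E` is bounded, the unreached masses are summable and so tend to zero.
  have hpart (n : ℕ) : ∑ k ∈ Finset.range n, ε * B k ≤ W 0 - W n + (E n - E 0) := by
    induction n with
    | zero => simp
    | succ n ih => rw [Finset.sum_range_succ]; linarith [hstep n]
  have hS : Summable fun n => ε * B n :=
    summable_of_sum_range_le (c := W 0 + L) (fun n => mul_nonneg hε.le (hB0 n)) fun n => by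
      linarith [hpart n, hW0 n, hE0 0, hL n]
  simpa [hε.ne'] using hS.tendsto_atTop_zero.const_mul ε⁻¹

theorem sum_newEnergy [Fintype ι] (ha : ConsistentWeights g ν C a)
    (hg : ∀ i, Function.Injective (g i)) (hsum : ∀ t, ∑ i, ‖ν i t‖ ^ 2 = 1)
    (hC : IsInvariantSet g ν (C : Set T)) (hbC : ∀ j, b j ∈ C)
    (hb : ∀ j k γ, wordMap g γ (b j) = b k → wordWeight g ν γ (b j) ≠ 0 → j = k) (n : ℕ) :
    ∑ k ∈ Finset.range (n + 1), ∑ ω ∈ wordsOfLength N k, newEnergy g ν b a ω =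
      ∑ ω ∈ wordsOfLength N n, reachedEnergy g ν b C a ω := by
  classical
  induction n with
  | zero =>
    have hnil (j : ι) : [] ∈ wordsNotEndingInCycle g ν (b j) :=
      mem_wordsNotEndingInCycle_iff.2 fun γ hγ hne => absurd (List.suffix_nil.1 hγ) hne
    have himg : C.filter (ReachedFrom g ν b []) = Finset.univ.image b := by
      ext c
      simp only [Finset.mem_filter, Finset.mem_image, Finset.mem_univ, true_and]
      constructor
      · rintro ⟨-, j, γ, hγ, rfl, -⟩
        obtain rfl := List.suffix_nil.1 hγ
        exact ⟨j, rfl⟩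
      · rintro ⟨j, rfl⟩
        exact ⟨hbC j, reachedFrom_base _ j⟩
    simp only [zero_add, Finset.sum_range_one, sum_wordsOfLength_zero, newEnergy, hnil, if_true,
      reachedEnergy]
    have hinj : Function.Injective b := fun j k h => hb j k [] h one_ne_zero
    rw [himg, Finset.sum_image fun j _ k _ h => hinj h]
  | succ n ih =>
    rw [Finset.sum_range_succ, ih, sum_wordsOfLength_succ, sum_wordsOfLength_succ,
      ← Finset.sum_add_distrib]
    exact Finset.sum_congr rfl fun ω _ =>
      (sum_reachedEnergy_concat ha hg hsum hC hbC hb ω).symm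

theorem hasSum_newEnergy [Fintype ι] (ha : ConsistentWeights g ν C a) (ha0 : ∀ ω c, 0 ≤ a ω c)
    (hg : ∀ i, Function.Injective (g i)) (hsum : ∀ t, ∑ i, ‖ν i t‖ ^ 2 = 1)
    (hC : IsInvariantSet g ν (C : Set T)) (hbC : ∀ j, b j ∈ C)
    (hb : ∀ j k γ, wordMap g γ (b j) = b k → wordWeight g ν γ (b j) ≠ 0 → j = k)
    (hpath : ∀ c ∈ C, ∃ ω j, wordMap g ω c = b j ∧ wordWeight g ν ω c ≠ 0) {L : ℝ}
    (hL : Tendsto (fun n => ∑ ω ∈ wordsOfLength N n, ∑ c ∈ C, a ω c) atTop (𝓝 L)) :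
    HasSum (newEnergy g ν b a) L := by
  classical
  have h0 (ω : List (Fin N)) : 0 ≤ newEnergy g ν b a ω :=
    Finset.sum_nonneg fun j _ => by split_ifs <;> simp [ha0]
  refine hasSum_of_tendsto_sum_wordsOfLength h0 ?_
  have hmono : Monotone fun n => ∑ ω ∈ wordsOfLength N n, ∑ c ∈ C, a ω c :=
    monotone_nat_of_le_succ fun n => by
      rw [sum_wordsOfLength_succ]
      exact Finset.sum_le_sum fun ω _ => ha.sum_le ha0 hg hsum hC ω
  have hB := tendsto_sum_unreachedEnergy ha ha0 hg hsum hC hpath (hmono.ge_of_tendsto hL)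
  have h := hL.sub hB
  rw [sub_zero] at h
  refine h.congr fun n => ?_
  rw [sum_newEnergy ha hg hsum hC hbC hb, ← Finset.sum_sub_distrib]
  exact Finset.sum_congr rfl fun ω _ =>
    sub_eq_of_eq_add (reachedEnergy_add_unreachedEnergy a ω).symm

end Energy

theorem consistentWeights_of_reversing {K : Type*} [NormedAddCommGroup K] [InnerProductSpace ℂ K]
    {T : Type*} {N : ℕ} {V : Fin N → K →L[ℂ] K} {e : T → K} {g : Fin N → T → T}
    {ν : Fin N → T → ℂ} {C : Finset T}
    (hrev : ∀ i, ∀ c ∈ C, ν i c ≠ 0 → V i (e (g i c)) = (starRingEnd ℂ) (ν i c) • e c) (v : K) :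
    ConsistentWeights g ν C fun ω c => ‖inner ℂ v (wordOp V ω (e c))‖ ^ 2 := by
  intro ω c hc i hi
  beta_reduce
  rw [wordOp_concat, ContinuousLinearMap.comp_apply, hrev i c hc hi, map_smul, inner_smul_right,
    norm_mul, mul_pow, RCLike.norm_conj]

/-! ### Defects of the vectors `V_ω^* v` -/

section Operators

variable {K : Type*} [NormedAddCommGroup K] [InnerProductSpace ℂ K] [CompleteSpace K]
  {T : Type*} {N : ℕ} {V : Fin N → K →L[ℂ] K} {e : T → K} {g : Fin N → T → T}
  {ν : Fin N → T → ℂ} {C : Finset T}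

/-- The growth of mass from the empty word to words of length one; at `x = e t` it makes the defect
superharmonic. -/
theorem sum_defect_adjoint_le (hV : IsRowCoisometry V) (hg : ∀ i, Function.Injective (g i))
    (hsum : ∀ t, ∑ i, ‖ν i t‖ ^ 2 = 1) (hC : IsInvariantSet g ν (C : Set T))
    (hrev : ∀ i, ∀ c ∈ C, ν i c ≠ 0 → V i (e (g i c)) = (starRingEnd ℂ) (ν i c) • e c) (x : K) :
    ∑ i, defect e C (ContinuousLinearMap.adjoint (V i) x) ≤ defect e C x := by
  have h := (consistentWeights_of_reversing hrev x).sum_le (fun _ _ => by positivity) hg hsum hC []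
  simp only [defect, Finset.sum_sub_distrib, hV.sum_norm_sq,
    ContinuousLinearMap.adjoint_inner_left]
  exact sub_le_sub_left h _

theorem sum_words_defect (hV : IsRowCoisometry V) (n : ℕ) (v : K) :
    ∑ ω ∈ wordsOfLength N n, defect e C (ContinuousLinearMap.adjoint (wordOp V ω) v) =
      ‖v‖ ^ 2 - ∑ ω ∈ wordsOfLength N n, ∑ c ∈ C, ‖inner ℂ v (wordOp V ω (e c))‖ ^ 2 := by
  simp only [defect, Finset.sum_sub_distrib, hV.sum_words_norm_sq,
    ContinuousLinearMap.adjoint_inner_left]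

/-- If the mass of the vectors `V_ω^* v` off the span of `(e_c)` tends to zero for `v` in a family
with dense span, it does so for all `v`. -/
theorem tendsto_sum_words_defect_of_dense (hV : IsRowCoisometry V)
    (hC : Orthonormal ℂ fun c : C => e c) {A : Set K}
    (hA : (Submodule.span ℂ A).topologicalClosure = ⊤)
    (h : ∀ v ∈ A, Tendsto (fun n => ∑ ω ∈ wordsOfLength N n,
      defect e C (ContinuousLinearMap.adjoint (wordOp V ω) v)) atTop (𝓝 0)) (v : K) :
    Tendsto (fun n => ∑ ω ∈ wordsOfLength N n,
      defect e C (ContinuousLinearMap.adjoint (wordOp V ω) v)) atTop (𝓝 0) := by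
  set R : ℕ → K → ℝ := fun n v => ∑ ω ∈ wordsOfLength N n,
    defect e C (ContinuousLinearMap.adjoint (wordOp V ω) v) with hR
  have hR0 (n : ℕ) (x : K) : 0 ≤ R n x := Finset.sum_nonneg fun ω _ => defect_nonneg hC _
  have hRle (n : ℕ) (x : K) : R n x ≤ ‖x‖ ^ 2 := by
    rw [← hV.sum_words_norm_sq n x]
    exact Finset.sum_le_sum fun ω _ => defect_le _
  have hRadd (n : ℕ) (x y : K) : R n (x + y) ≤ 2 * R n x + 2 * R n y := by
    simp only [hR, Finset.mul_sum, ← Finset.sum_add_distrib, map_add]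
    exact Finset.sum_le_sum fun ω _ => defect_add_le hC _ _
  have hspan : ∀ w ∈ Submodule.span ℂ A, Tendsto (fun n => R n w) atTop (𝓝 0) := by
    intro w hw
    induction hw using Submodule.span_induction with
    | mem x hx => exact h x hx
    | zero => simp [hR, defect]
    | add x y _ _ hx hy =>
      have := (hx.const_mul 2).add (hy.const_mul 2)
      rw [mul_zero, add_zero] at this
      exact squeeze_zero (fun n => hR0 n _) (fun n => hRadd n x y) this
    | smul r x _ hx =>
      simpa only [hR, map_smul, defect_smul, ← Finset.mul_sum, mul_zero] using
        hx.const_mul (‖r‖ ^ 2)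
  change Tendsto (fun n => R n v) atTop (𝓝 0)
  rw [Metric.tendsto_atTop]
  intro ε hε
  have hv : v ∈ closure (Submodule.span ℂ A : Set K) := by
    rw [← Submodule.topologicalClosure_coe, hA]; trivial
  -- Chosen so that `R n v ≤ 2 ‖v - w‖² + 2 R n w < ε`; the bound `R n x ≤ ‖x‖²` is uniform in `n`.
  obtain ⟨w, hw, hvw⟩ := Metric.mem_closure_iff.1 hv (√(ε / 4)) (by positivity)
  have hsq : ‖v - w‖ ^ 2 < ε / 4 := by
    rw [dist_eq_norm] at hvw
    exact (Real.lt_sqrt (norm_nonneg _)).1 hvw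
  obtain ⟨n₀, hn₀⟩ := Metric.tendsto_atTop.1 (hspan w hw) (ε / 4) (by positivity)
  refine ⟨n₀, fun n hn => ?_⟩
  have h1 := hn₀ n hn
  have h2 := hRadd n (v - w) w
  rw [sub_add_cancel] at h2
  rw [Real.dist_eq, sub_zero, abs_of_nonneg (hR0 n _)] at h1 ⊢
  linarith [hRle n (v - w)]

end Operators

/-! ### The Parseval frame -/

namespace CoisometryAssumptions

variable {K : Type*} [NormedAddCommGroup K] [InnerProductSpace ℂ K] [CompleteSpace K]
  {T : Type*} [MetricSpace T] [CompleteSpace T] {N : ℕ} {V : Fin N → K →L[ℂ] K} {e : T → K}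
  {g : Fin N → T → T} {ν : Fin N → T → ℂ} {C : Finset T}

theorem tendsto_sum_words_inner (hV : CoisometryAssumptions V e g ν)
    (hg : ∀ i, Function.Injective (g i)) (hC : IsInvariantSet g ν (C : Set T))
    (horth : Orthonormal ℂ fun c : C => e c)
    (hmin : ∀ M, IsMinimalCompactInvariant g ν M → M ⊆ C)
    (hrev : ∀ i, ∀ c ∈ C, ν i c ≠ 0 → V i (e (g i c)) = (starRingEnd ℂ) (ν i c) • e c) (v : K) :
    Tendsto (fun n => ∑ ω ∈ wordsOfLength N n, ∑ c ∈ C, ‖inner ℂ v (wordOp V ω (e c))‖ ^ 2)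
      atTop (𝓝 (‖v‖ ^ 2)) := by
  have hlim := tendsto_sum_words_defect_of_dense hV.coisometry horth hV.dense_span
    (C := C) (e := e) ?_ v
  · simp_rw [sum_words_defect hV.coisometry] at hlim
    have h := hlim.const_sub (‖v‖ ^ 2)
    rw [sub_zero] at h
    exact h.congr fun n => sub_sub_cancel _ _
  · rintro _ ⟨t, rfl⟩
    simp_rw [adjoint_wordOp_apply hV.adjoint_apply, defect_smul]
    simp_rw [sum_wordWeight_sq_mul (fun t => defect e C (e t))]
    refine tendsto_iterate_transferOp hV.continuous_map hV.continuous_norm_weight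
      hV.sum_norm_sq (continuous_defect.comp hV.continuous) (fun t => defect_nonneg horth _)
      (fun t => ?_) (fun M hM c hc => defect_apply_self horth (hmin M hM hc))
      (isCompact_closure_wordOrbit hV.contraction t)
      (isInvariantSet_closure_wordOrbit hV.continuous_map ν t)
      (subset_closure ⟨[], rfl⟩)
    have h := sum_defect_adjoint_le hV.coisometry hg hV.sum_norm_sq hC hrev (e t)
    simp only [hV.adjoint_apply, defect_smul] at h
    exact h

theorem isParsevalFrame (hV : CoisometryAssumptions V e g ν)
    (hg : ∀ i, Function.Injective (g i))
    (hfin : ∀ M : Set T, IsMinimalCompactInvariant g ν M → M.Finite)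
    (hrev : ∀ M : Set T, IsMinimalCompactInvariant g ν M →
      WalkReversing V (fun t : M => e t) (restrictMaps g M) (restrictWeights ν M))
    (c : ∀ M : {M : Set T // IsMinimalCompactInvariant g ν M}, M.1) :
    IsParsevalFrame (fun a : Σ M : {M : Set T // IsMinimalCompactInvariant g ν M},
        wordsNotEndingInCycle (restrictMaps g M.1) (restrictWeights ν M.1) (c M) =>
      wordOp V a.2.1 (e (c a.1))) := by
  classical
  have : Finite {M : Set T // IsMinimalCompactInvariant g ν M} := hV.finite_minimal hg hfin
  have := Fintype.ofFinite {M : Set T // IsMinimalCompactInvariant g ν M}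
  set C : Finset T := (hV.finite_sUnion_minimal hg hfin).toFinset with hCdef
  have hmem {t : T} : t ∈ C ↔ ∃ M, IsMinimalCompactInvariant g ν M ∧ t ∈ M := by
    simp [hCdef]
  have hC : IsInvariantSet g ν (C : Set T) := by
    intro t ht i hi
    obtain ⟨M, hM, htM⟩ := hmem.1 ht
    exact hmem.2 ⟨M, hM, hM.prop.2.2 t htM i hi⟩
  have horth : Orthonormal ℂ fun c : C => e c :=
    (hV.orthonormal_minimal hg hfin).comp
      (fun c : C => ⟨c, (hV.finite_sUnion_minimal hg hfin).mem_toFinset.1 c.2⟩)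
      fun _ _ h => Subtype.ext (Subtype.mk.inj h)
  have hrev' : ∀ i, ∀ t ∈ C, ν i t ≠ 0 →
      V i (e (g i t)) = (starRingEnd ℂ) (ν i t) • e t := by
    intro i t ht hi
    obtain ⟨M, hM, htM⟩ := hmem.1 ht
    have h := hrev M hM i ⟨t, htM⟩ hi
    beta_reduce at h
    rwa [coe_restrictMaps hM.prop.2.2 (c := ⟨t, htM⟩) hi] at h
  intro v
  have h := hasSum_newEnergy (b := fun M => (c M : T))
    (consistentWeights_of_reversing hrev' v) (fun _ _ => by positivity) hg hV.sum_norm_sq hC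
    (fun M => hmem.2 ⟨M.1, M.2, (c M).2⟩) ?_ ?_
    (hV.tendsto_sum_words_inner hg hC horth
      (fun M hM t ht => hmem.2 ⟨M, hM, ht⟩) hrev' v)
  · refine hasSum_sigma_of_hasSum_sum_indicator
      (f := fun M ω => ‖inner ℂ v (wordOp V ω (e (c M)))‖ ^ 2) (fun _ _ => by positivity) ?_
    convert h using 1
    ext ω
    refine Finset.sum_congr rfl fun M _ => ?_
    rw [Set.indicator_apply, wordsNotEndingInCycle_restrict M.2.prop.2.2]
  -- No path of nonzero weight joins different base points: it stays in `M`, and minimal sets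
  -- sharing a point coincide.
  · intro M M' γ hγ hw
    refine Subtype.ext (M.2.eq_of_mem M'.2 (M.2.prop.2.2.wordMap_mem (c M).2 hw) ?_)
    rw [hγ]
    exact (c M').2
  · intro t ht
    obtain ⟨M, hM, htM⟩ := hmem.1 ht
    obtain ⟨ω, hω, hw⟩ := hM.exists_word (hfin M hM) htM (c ⟨M, hM⟩).2
    exact ⟨ω, ⟨M, hM⟩, hω, hw⟩

end CoisometryAssumptions

theorem theorem2p11 {K : Type*} [NormedAddCommGroup K] [InnerProductSpace ℂ K] [CompleteSpace K]
    {T : Type*} [MetricSpace T] [CompleteSpace T] {N : ℕ}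
    (V : Fin N → K →L[ℂ] K) (e : T → K) (g : Fin N → T → T) (ν : Fin N → T → ℂ)
    (hV : CoisometryAssumptions V e g ν)
    (hg : ∀ i, Function.Injective (g i))
    (hfin : ∀ M : Set T, IsMinimalCompactInvariant g ν M → M.Finite) :
    {M : Set T | IsMinimalCompactInvariant g ν M}.Finite ∧
    (∀ M : Set T, IsMinimalCompactInvariant g ν M →
      ActsAsRandomWalk V (spanOn e M) (fun t : M => e t) (restrictMaps g M)
        (restrictWeights ν M) ∧
      WalkIrreducible (restrictMaps g M) (restrictWeights ν M) ∧
      WalkSeparating (restrictMaps g M) (restrictWeights ν M)) ∧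
    ((∀ M : Set T, IsMinimalCompactInvariant g ν M →
        WalkReversing V (fun t : M => e t) (restrictMaps g M) (restrictWeights ν M)) →
      ∀ c : ∀ M : {M : Set T // IsMinimalCompactInvariant g ν M}, M.1,
        IsParsevalFrame (fun a : Σ M : {M : Set T // IsMinimalCompactInvariant g ν M},
            wordsNotEndingInCycle (restrictMaps g M.1) (restrictWeights ν M.1) (c M) =>
          wordOp V a.2.1 (e (c a.1)))) :=
  ⟨hV.finite_minimal hg hfin,
    fun M hM => ⟨hV.actsAsRandomWalk_minimal hg hfin hM, walkIrreducible_of_finite (hfin M hM) hM,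
      hV.walkSeparating_minimal hg (hfin M hM) hM⟩,
    fun hrev c => hV.isParsevalFrame hg hfin hrev c⟩
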